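/- Let $X$ be a random variable with values in $\{0,\dots,n\}$ for some $n$, with mean $\mu$ and standard deviation $\sigma$. Let $f_X(z)=\mathbb{E}\,z^X$ be its probability generating function, $u_X(z)=\log|f_X(z)|$ its logarithmic potential, and $a_j=\kappa_j/j!$ its normalized cumulants, where $\kappa_j$ is the $j$-th derivative at $t=0$ of $t\mapsto\log\mathbb{E}\,e^{tX}$. Write $B(z_0,r)=\{z\in\mathbb{C}:|z-z_0|<r\}$. For $b\ge 0$, a function $u$ is called $b$-decreasing in $\Omega\subseteq\mathbb{C}$ if $u(\rho e^{i\theta_1})-u(\rho e^{i\theta_2})+b\ge 0$ for all $\rho>0$ and $0\le\theta_1\le\theta_2\le\pi$ with $\rho e^{i\theta_1},\rho e^{i\theta_2}\in\Omega$. There are absolute constants $c_1>0$, $c_2\in(0,1/2)$ and $C>0$ such that the following holds for every such $X$ and all $\varepsilon\in(0,1)$, $b\ge 0$. Suppose that $u_X$ is $b$-decreasing and harmonic in $B(1,\varepsilon)$ and that $$\sum_{j\ge 2}|a_j|\,(\varepsilon/32)^j>b .$$ Then $\sigma>0$, and with $X^*=(X-\mu)/\sigma$ and $\psi_{X^*}(\xi)=\mathbb{E}\,e^{i\xi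 X^*}$ for $\xi\in\mathbb{C}$: 1. There is a holomorphic function $R$ on $B(0,\varepsilon\sigma/2)$ with $$\psi_{X^*}(\xi)=\exp\left(-\xi^2/2+R(\xi)\right)\qquad\text{for all } \xi\in\mathbb{C},\ |\xi|<\varepsilon\sigma/2,$$ such that $R(0)=R'(0)=R''(0)=0$, $|R^{(\ell)}(0)|\le \ell!\,(c_2\varepsilon\sigma)^{2-\ell}$ for all integers $\ell\ge 3$, and $$|R(\xi)|\le \frac{c_1|\xi|^3}{\varepsilon\sigma}\qquad\text{for all } \xi\in\mathbb{C}\text{ with } |\xi|\le c_2\varepsilon\sigma .$$ 2. If $Z\sim N(0,1)$ is a standard normal random variable, then $$\sup_{t\in\mathbb{R}}\left|\mathbb{P}(X^*\le t)-\mathbb{P}(Z\le t)\right|\le\frac{C}{\varepsilon\sigma}.$$ -/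

import Mathlib

open MeasureTheory ProbabilityTheory

noncomputable section

namespace LogPotential

/-- The probability generating function `f_X(z) = 𝔼 z ^ X` of a random variable `X` with values
in `ℕ`. -/
def pgf {Ω : Type*} [MeasurableSpace Ω] (P : Measure Ω) (X : Ω → ℕ) (z : ℂ) : ℂ :=
  ∫ ω, z ^ X ω ∂P

/-- The logarithmic potential `u_X(z) = log |f_X(z)|`. At a zero of `f_X` (where the potential
is `-∞`) the value is `0`; such a point is never in a domain where `u_X` is harmonic, because
`u_X` is unbounded near it. -/
def potential {Ω : Type*} [MeasurableSpace Ω] (P : Measure Ω) (X : Ω → ℕ) (z : ℂ) : ℝ :=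
  Real.log ‖pgf P X z‖

/-- `u` is `b`-decreasing in `D`: `u(ρ e^{iθ₁}) - u(ρ e^{iθ₂}) + b ≥ 0` for all
`0 ≤ θ₁ ≤ θ₂ ≤ π` such that both points lie in `D`. -/
def IsBDecreasingOn (b : ℝ) (u : ℂ → ℝ) (D : Set ℂ) : Prop :=
  ∀ ρ θ₁ θ₂ : ℝ, 0 < ρ → 0 ≤ θ₁ → θ₁ ≤ θ₂ → θ₂ ≤ Real.pi →
    (ρ : ℂ) * Complex.exp (θ₁ * Complex.I) ∈ D →
    (ρ : ℂ) * Complex.exp (θ₂ * Complex.I) ∈ D →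
    0 ≤ u (ρ * Complex.exp (θ₁ * Complex.I)) - u (ρ * Complex.exp (θ₂ * Complex.I)) + b

/-- The `j`-th cumulant of a real random variable: the `j`-th derivative at `0` of the cumulant
generating function `t ↦ log 𝔼 e^{tY}`. -/
def cumulant {Ω : Type*} [MeasurableSpace Ω] (P : Measure Ω) (Y : Ω → ℝ) (j : ℕ) : ℝ :=
  iteratedDeriv j (cgf Y P) 0

/-- The normalized cumulant `a_j = κ_j / j!`. -/
def normalizedCumulant {Ω : Type*} [MeasurableSpace Ω] (P : Measure Ω) (X : Ω → ℕ) (j : ℕ) : ℝ :=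
  cumulant P (fun ω => (X ω : ℝ)) j / (Nat.factorial j : ℝ)

/-- The standard deviation of `X`. -/
def stdDev {Ω : Type*} [MeasurableSpace Ω] (P : Measure Ω) (X : Ω → ℕ) : ℝ :=
  Real.sqrt (variance (fun ω => (X ω : ℝ)) P)

/-- The normalization `X* = (X - 𝔼 X) / σ`. -/
def standardized {Ω : Type*} [MeasurableSpace Ω] (P : Measure Ω) (X : Ω → ℕ) (ω : Ω) : ℝ :=
  ((X ω : ℝ) - ∫ ω', (X ω' : ℝ) ∂P) / stdDev P X

/-- The characteristic function `ψ_Y(ξ) = 𝔼 e^{iξY}`, at complex arguments `ξ`. -/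
def charFn {Ω : Type*} [MeasurableSpace Ω] (P : Measure Ω) (Y : Ω → ℝ) (ξ : ℂ) : ℂ :=
  ∫ ω, Complex.exp (Complex.I * ξ * (Y ω : ℂ)) ∂P

end LogPotential

end

/-! Put φ(w) = log f_X(e^w). Harmonicity of u_X rules out zeros of f_X near 1, so φ is holomorphic
on |w| < ε/2; its derivatives at 0 are the cumulants, and Re φ(w) = u_X(e^w). Being b-decreasing
says that Re φ(x + iy) decreases in |y| up to an error b. If b were 0, the Cauchy-Riemann equations
would give Im φ' ≥ 0 in the upper half disc, so φ' would be typically real. For b > 0, averaging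
over conjugate points of a circle replaces differentiation and gives Im φ' ≥ -B with B of order b/ε
(`neg_le_im_deriv`).

Rogosinski's argument for typically real functions then applies: |sin kt| ≤ k sin t on [0, π] bounds
every coefficient of φ' by the first one, which is σ² (`abs_coeff_le_of_im_ge`). With r = ε/5 this
reads |a_j| r^j ≤ r²σ² + 2b (`abs_normalizedCumulant_le`). Summed at the smaller radius ε/32, these
bounds and the lower bound b on the sum force b ≤ r²σ²/4 and σ > 0 (`le_div_four_of_lt_tsum`).

Hence |a_j| r^j ≤ (3/2) r²σ². After rescaling by σ, the part of log ψ of order at least 3 is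
dominated by a geometric series in |ξ|/(rσ), which gives the bounds on R. So ψ is close to
exp(-ξ²/2) on a real interval of length of order εσ, and an Esseen smoothing inequality, proved with
the Fejér kernel (`abs_real_Iic_sub_gaussian_le`), turns this into the bound on distribution
functions. -/

noncomputable section

/-! ### Sine coefficients on circles and one-sided bounds. -/

namespace LogPotential

open Complex Metric

/-- The sine coefficients of a holomorphic function on a circle. -/
theorem integral_circleMap_mul_sin {g : ℂ → ℂ} {w : ℂ} {d : ℝ} (hd : 0 < d)
    (hg : DiffContOnCl ℂ g (ball w d)) (m : ℕ) :
    ∫ t in (0 : ℝ)..2 * Real.pi, g (circleMap w d t) * (Real.sin ((m + 1 : ℕ) * t) : ℂ)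
      = Real.pi * I * d ^ (m + 1) * (iteratedDeriv (m + 1) g w / (m + 1).factorial) := by
  -- With E = exp(it), sin((m+1)t) = (E^(m+1) - E^(-(m+1)))/(2i). The negative power picks out a
  -- Taylor coefficient (`hA`); the positive one vanishes by Cauchy's theorem (`hB`). The exponent
  -- in `hB` is m because dz supplies one more factor E.
  have hA := hg.circleIntegral_one_div_sub_center_pow_smul hd (m + 1)
  have hB : (∮ z in C(w, d), (z - w) ^ m * g z) = 0 := by
    have h : DiffContOnCl ℂ (fun z => (z - w) ^ m * g z) (ball w d) := by
      refine DiffContOnCl.smul (f := g) (c := fun z => (z - w) ^ m) ?_ hg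
      exact Differentiable.diffContOnCl (by fun_prop)
    exact h.circleIntegral_eq_zero hd.le
  have hgc : Continuous fun t : ℝ => g (circleMap w d t) := by
    have h1 : ContinuousOn g (closedBall w d) := by
      have := hg.continuousOn
      rwa [closure_ball w hd.ne'] at this
    refine h1.comp_continuous (continuous_circleMap w d) fun t => ?_
    exact sphere_subset_closedBall (circleMap_mem_sphere w hd.le t)
  have hne : ∀ t, circleMap 0 d t ≠ 0 := fun t => circleMap_ne_center hd.ne'
  simp only [circleIntegral, deriv_circleMap, circleMap_sub_center, smul_eq_mul] at hA hB
  have hdc : (d : ℂ) ≠ 0 := by exact_mod_cast hd.ne'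
  have key : ∀ t : ℝ, g (circleMap w d t) * (Real.sin ((m + 1 : ℕ) * t) : ℂ)
      = d ^ (m + 1) / 2 * (circleMap 0 d t * I *
          (1 / circleMap 0 d t ^ (m + 1 + 1) * g (circleMap w d t)))
        - 1 / (2 * d ^ (m + 1)) * (circleMap 0 d t * I *
          (circleMap 0 d t ^ m * g (circleMap w d t))) := by
    intro t
    have e1 : exp ((((m + 1 : ℕ) : ℂ) * t) * I) = exp (t * I) ^ (m + 1) := by
      rw [← Complex.exp_nat_mul]; ring_nf
    have e2 : exp (-(((m + 1 : ℕ) : ℂ) * t) * I) = (exp (t * I) ^ (m + 1))⁻¹ := by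
      rw [← e1, ← Complex.exp_neg]; ring_nf
    have hE := Complex.exp_ne_zero (t * I)
    push_cast [Complex.ofReal_sin]
    rw [Complex.sin, circleMap_zero]
    push_cast at e1 e2
    rw [e1, e2]
    field_simp
    ring
  simp_rw [key]
  have hc0 : Continuous fun t : ℝ => circleMap 0 d t := continuous_circleMap 0 d
  rw [intervalIntegral.integral_sub, intervalIntegral.integral_const_mul,
    intervalIntegral.integral_const_mul, hA, hB]
  · field_simp
    ring
  · refine Continuous.intervalIntegrable ?_ _ _
    refine continuous_const.mul ((hc0.mul continuous_const).mul (Continuous.mul ?_ hgc))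
    exact continuous_const.div (hc0.pow _) fun t => pow_ne_zero _ (hne t)
  · refine Continuous.intervalIntegrable ?_ _ _
    exact continuous_const.mul ((hc0.mul continuous_const).mul ((hc0.pow _).mul hgc))

/-- Folding an integral over the circle against an odd weight to the upper half circle. -/
theorem integral_mul_sin_fold {G : ℝ → ℝ} (hG : Continuous G) (k : ℕ) :
    ∫ t in (0 : ℝ)..2 * Real.pi, G t * Real.sin (k * t)
      = ∫ t in (0 : ℝ)..Real.pi, (G t - G (2 * Real.pi - t)) * Real.sin (k * t) := by
  have hi : ∀ a b : ℝ, IntervalIntegrable (fun t => G t * Real.sin (k * t)) volume a b :=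
    fun a b => Continuous.intervalIntegrable (by fun_prop) _ _
  rw [← intervalIntegral.integral_add_adjacent_intervals (hi 0 Real.pi) (hi Real.pi _)]
  have h2 : ∫ t in Real.pi..2 * Real.pi, G t * Real.sin (k * t)
      = ∫ t in (0 : ℝ)..Real.pi, -(G (2 * Real.pi - t) * Real.sin (k * t)) := by
    have := intervalIntegral.integral_comp_sub_left
      (a := 0) (b := Real.pi) (fun t => G t * Real.sin (k * t)) (2 * Real.pi)
    rw [show 2 * Real.pi - Real.pi = Real.pi by ring, sub_zero] at this
    rw [← this]
    refine intervalIntegral.integral_congr fun t _ => ?_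
    rw [show (k : ℝ) * (2 * Real.pi - t) = k * (2 * Real.pi) - k * t by ring,
      Real.sin_nat_mul_two_pi_sub]
    ring
  rw [h2, ← intervalIntegral.integral_add]
  · refine intervalIntegral.integral_congr fun t _ => ?_
    ring
  · exact hi _ _
  · exact Continuous.intervalIntegrable (by fun_prop) _ _

/-- Rogosinski's inequality: against a nonnegative weight on [0, π], it bounds the k-th sine
coefficient by k times the first. -/
theorem abs_sin_nat_mul_le (k : ℕ) (t : ℝ) : |Real.sin (k * t)| ≤ k * |Real.sin t| := by
  induction k with
  | zero => simp
  | succ k ih =>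
    have h : Real.sin ((k + 1 : ℕ) * t)
        = Real.sin (k * t) * Real.cos t + Real.cos (k * t) * Real.sin t := by
      rw [← Real.sin_add]; push_cast; ring_nf
    rw [h]
    calc _ ≤ |Real.sin (k * t) * Real.cos t| + |Real.cos (k * t) * Real.sin t| := abs_add_le _ _
      _ ≤ |Real.sin (k * t)| * 1 + 1 * |Real.sin t| := by
          rw [abs_mul, abs_mul]
          gcongr
          · exact Real.abs_cos_le_one t
          · exact Real.abs_cos_le_one _
      _ ≤ ((k + 1 : ℕ) : ℝ) * |Real.sin t| := by push_cast; linarith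

theorem circleMap_two_pi_sub (c : ℂ) (d t : ℝ) :
    circleMap c d (2 * Real.pi - t) = circleMap c d (-t) := by
  have := periodic_circleMap c d (-t)
  rw [← this]; ring_nf

/-- A one-sided bound for differences over conjugate points of a circle bounds the imaginary part
of the derivative at the centre from below. -/
theorem neg_le_im_deriv {φ : ℂ → ℂ} {w : ℂ} {d b : ℝ} (hd : 0 < d)
    (hφ : DiffContOnCl ℂ φ (ball w d))
    (h : ∀ t ∈ Set.Icc 0 Real.pi,
      (φ (circleMap w d t)).re - (φ (circleMap w d (-t))).re ≤ b) :
    -(2 * b / (Real.pi * d)) ≤ (deriv φ w).im := by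
  have hgc : Continuous fun t : ℝ => φ (circleMap w d t) := by
    have h1 : ContinuousOn φ (closedBall w d) := by
      have := hφ.continuousOn
      rwa [closure_ball w hd.ne'] at this
    refine h1.comp_continuous (continuous_circleMap w d) fun t => ?_
    exact sphere_subset_closedBall (circleMap_mem_sphere w hd.le t)
  have h1 := integral_circleMap_mul_sin hd hφ 0
  -- The first sine coefficient of φ is πi d φ'(w), and Re(iζ) = -Im ζ.
  have h2 : ∫ t in (0 : ℝ)..2 * Real.pi, (φ (circleMap w d t)).re * Real.sin ((1 : ℕ) * t)
      = -(Real.pi * d * (deriv φ w).im) := by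
    have h3 := congrArg Complex.re h1
    rw [← Complex.reCLM_apply, ← ContinuousLinearMap.intervalIntegral_comp_comm] at h3
    · simp only [Complex.reCLM_apply, zero_add, Complex.re_mul_ofReal] at h3
      rw [h3]
      simp [iteratedDeriv_one]
    · exact Continuous.intervalIntegrable (hgc.mul (Complex.continuous_ofReal.comp (by fun_prop))) _ _
  have h2' := integral_mul_sin_fold (Complex.continuous_re.comp hgc) 1
  simp only [Function.comp_apply] at h2'
  rw [h2'] at h2
  have h4 : ∫ t in (0 : ℝ)..Real.pi, ((φ (circleMap w d t)).re
      - (φ (circleMap w d (2 * Real.pi - t))).re) * Real.sin ((1 : ℕ) * t)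
      ≤ ∫ t in (0 : ℝ)..Real.pi, b * Real.sin t := by
    refine intervalIntegral.integral_mono_on Real.pi_pos.le ?_ ?_ fun t ht => ?_
    · refine Continuous.intervalIntegrable ?_ _ _
      have : Continuous fun t : ℝ => φ (circleMap w d (2 * Real.pi - t)) :=
        hgc.comp (continuous_const.sub continuous_id)
      exact ((Complex.continuous_re.comp hgc).sub (Complex.continuous_re.comp this)).mul
        (by fun_prop)
    · exact Continuous.intervalIntegrable (by fun_prop) _ _
    · rw [circleMap_two_pi_sub]
      simp only [Nat.cast_one, one_mul]
      exact mul_le_mul_of_nonneg_right (h t ht) (Real.sin_nonneg_of_mem_Icc ht)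
  rw [h2, intervalIntegral.integral_const_mul, integral_sin] at h4
  simp only [Real.cos_zero, Real.cos_pi] at h4
  have hp := Real.pi_pos
  rw [neg_le, ← sub_nonneg]
  have : 2 * b / (Real.pi * d) - -(deriv φ w).im
    = (2 * b - -(Real.pi * d * (deriv φ w).im)) / (Real.pi * d) := by field_simp
  rw [this]
  exact div_nonneg (by linarith) (by positivity)

/-- Coefficient bounds for a holomorphic function, real on the real axis, whose imaginary part is
at least `-B` on the upper half circle. -/
theorem abs_coeff_le_of_im_ge {g : ℂ → ℂ} {r B : ℝ} (hr : 0 < r)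
    (hg : DiffContOnCl ℂ g (ball 0 r))
    (hodd : ∀ t, (g (circleMap 0 r (-t))).im = -(g (circleMap 0 r t)).im)
    (h : ∀ t ∈ Set.Icc 0 Real.pi, -B ≤ (g (circleMap 0 r t)).im) (hB : 0 ≤ B) (m : ℕ) :
    r ^ (m + 1) * |(iteratedDeriv (m + 1) g 0).re / (m + 1).factorial|
      ≤ (m + 1) * (r * (deriv g 0).re + 8 * B / Real.pi) := by
  have hgc : Continuous fun t : ℝ => g (circleMap 0 r t) := by
    have h1 : ContinuousOn g (closedBall 0 r) := by
      have := hg.continuousOn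
      rwa [closure_ball 0 hr.ne'] at this
    refine h1.comp_continuous (continuous_circleMap 0 r) fun t => ?_
    exact sphere_subset_closedBall (circleMap_mem_sphere 0 hr.le t)
  set V : ℝ → ℝ := fun t => (g (circleMap 0 r t)).im with hV
  have hVc : Continuous V := Complex.continuous_im.comp hgc
  have hp := Real.pi_pos
  have hcoef : ∀ m : ℕ, ∫ t in (0 : ℝ)..Real.pi, V t * Real.sin ((m + 1 : ℕ) * t)
      = Real.pi / 2 * (r ^ (m + 1) * ((iteratedDeriv (m + 1) g 0).re / (m + 1).factorial)) := by
    intro m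
    have h3 := congrArg Complex.im (integral_circleMap_mul_sin hr hg m)
    rw [← Complex.imCLM_apply, ← ContinuousLinearMap.intervalIntegral_comp_comm] at h3
    · simp only [Complex.imCLM_apply, Complex.im_mul_ofReal] at h3
      rw [integral_mul_sin_fold hVc] at h3
      have h4 : ∀ t, (V t - V (2 * Real.pi - t)) * Real.sin ((m + 1 : ℕ) * t)
          = 2 * (V t * Real.sin ((m + 1 : ℕ) * t)) := by
        intro t
        have : V (2 * Real.pi - t) = - V t := by
          simp only [hV, circleMap_two_pi_sub, hodd]
        rw [this]; ring
      simp_rw [h4] at h3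
      rw [intervalIntegral.integral_const_mul] at h3
      have h5 : (Real.pi * I * r ^ (m + 1) *
          (iteratedDeriv (m + 1) g 0 / (m + 1).factorial) : ℂ).im
          = Real.pi * (r ^ (m + 1) * ((iteratedDeriv (m + 1) g 0).re / (m + 1).factorial)) := by
        have : (Real.pi * I * r ^ (m + 1) *
          (iteratedDeriv (m + 1) g 0 / (m + 1).factorial) : ℂ)
          = ((Real.pi * r ^ (m + 1) / (m + 1).factorial : ℝ) : ℂ) *
            (iteratedDeriv (m + 1) g 0 * I) := by
          push_cast; ring
        rw [this, Complex.im_ofReal_mul]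
        simp
        ring
      rw [h5] at h3
      linarith
    · exact Continuous.intervalIntegrable (hgc.mul (Complex.continuous_ofReal.comp (by fun_prop))) _ _
  have h0 : ∫ t in (0 : ℝ)..Real.pi, V t * Real.sin t = Real.pi / 2 * (r * (deriv g 0).re) := by
    have := hcoef 0
    simpa [iteratedDeriv_one] using this
  have hsin : ∫ t in (0 : ℝ)..Real.pi, Real.sin t = 2 := by
    rw [integral_sin]; simp; norm_num
  have hii : ∀ f : ℝ → ℝ, Continuous f → IntervalIntegrable f volume 0 Real.pi :=
    fun f hf => hf.intervalIntegrable _ _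
  have hbd : ∀ t ∈ Set.Icc 0 Real.pi, |Real.sin ((m + 1 : ℕ) * t)| ≤ (m + 1 : ℕ) * Real.sin t := by
    intro t ht
    have := abs_sin_nat_mul_le (m + 1) t
    rwa [abs_of_nonneg (Real.sin_nonneg_of_mem_Icc ht)] at this
  -- Only V + B is known to be nonnegative. The shift costs 2(m+1)B on the right and again 2(m+1)B
  -- when removed on the left, whence the 4B of `h5` and, after multiplication by 2/π, the 8B/π.
  have h1 : |∫ t in (0 : ℝ)..Real.pi, (V t + B) * Real.sin ((m + 1 : ℕ) * t)|
      ≤ ∫ t in (0 : ℝ)..Real.pi, (V t + B) * ((m + 1 : ℕ) * Real.sin t) := by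
    refine (intervalIntegral.abs_integral_le_integral_abs hp.le).trans ?_
    refine intervalIntegral.integral_mono_on hp.le (hii _ (by fun_prop)) (hii _ (by fun_prop))
      fun t ht => ?_
    have hn : 0 ≤ V t + B := by have := h t ht; simp only [hV]; linarith
    rw [abs_mul, abs_of_nonneg hn]
    exact mul_le_mul_of_nonneg_left (hbd t ht) hn
  have h2 : |∫ t in (0 : ℝ)..Real.pi, B * Real.sin ((m + 1 : ℕ) * t)| ≤ B * ((m + 1 : ℕ) * 2) := by
    refine (intervalIntegral.abs_integral_le_integral_abs hp.le).trans ?_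
    rw [← hsin, ← intervalIntegral.integral_const_mul, ← intervalIntegral.integral_const_mul]
    refine intervalIntegral.integral_mono_on hp.le (hii _ (by fun_prop)) (hii _ (by fun_prop))
      fun t ht => ?_
    rw [abs_mul, abs_of_nonneg hB]
    exact mul_le_mul_of_nonneg_left (hbd t ht) hB
  have h3 : ∫ t in (0 : ℝ)..Real.pi, (V t + B) * Real.sin ((m + 1 : ℕ) * t)
      = Real.pi / 2 * (r ^ (m + 1) * ((iteratedDeriv (m + 1) g 0).re / (m + 1).factorial))
        + ∫ t in (0 : ℝ)..Real.pi, B * Real.sin ((m + 1 : ℕ) * t) := by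
    rw [← hcoef, ← intervalIntegral.integral_add (hii _ (by fun_prop)) (hii _ (by fun_prop))]
    simp_rw [add_mul]
  have h4 : ∫ t in (0 : ℝ)..Real.pi, (V t + B) * ((m + 1 : ℕ) * Real.sin t)
      = (m + 1 : ℕ) * (Real.pi / 2 * (r * (deriv g 0).re) + B * 2) := by
    rw [← h0, ← hsin, ← intervalIntegral.integral_const_mul (r := B),
      ← intervalIntegral.integral_add (hii _ (by fun_prop)) (hii _ (by fun_prop)),
      ← intervalIntegral.integral_const_mul]
    refine intervalIntegral.integral_congr fun t _ => ?_
    ring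
  rw [h3, h4] at h1
  set Y := r ^ (m + 1) * ((iteratedDeriv (m + 1) g 0).re / (m + 1).factorial) with hY
  have h5 : Real.pi / 2 * |Y| ≤ (m + 1 : ℕ) * (Real.pi / 2 * (r * (deriv g 0).re) + B * 4) := by
    have h6 := abs_sub_abs_le_abs_sub (Real.pi / 2 * Y)
      (-∫ t in (0 : ℝ)..Real.pi, B * Real.sin ((m + 1 : ℕ) * t))
    rw [sub_neg_eq_add, abs_neg, abs_mul, abs_of_pos (by positivity : 0 < Real.pi / 2)] at h6
    linarith
  have h7 : |Y| = r ^ (m + 1) * |(iteratedDeriv (m + 1) g 0).re / (m + 1).factorial| := by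
    rw [hY, abs_mul, abs_of_pos (by positivity : 0 < r ^ (m + 1))]
  rw [← h7]
  push_cast at h5
  have h8 : |Y| = 2 / Real.pi * (Real.pi / 2 * |Y|) := by field_simp
  rw [h8]
  calc _ ≤ 2 / Real.pi * ((m + 1) * (Real.pi / 2 * (r * (deriv g 0).re) + B * 4)) := by gcongr
    _ = _ := by field_simp; ring

end LogPotential

end

/-! ### The logarithm of the generating function and the cumulants. -/

noncomputable section

namespace LogPotential

open Complex Metric Filter Topology

section Pgf

variable {Ω : Type*} [MeasurableSpace Ω] {P : Measure Ω} {X : Ω → ℕ} {n : ℕ}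

theorem pgf_eq_sum [IsProbabilityMeasure P] (hX : Measurable X) (hn : ∀ᵐ ω ∂P, X ω ≤ n) (z : ℂ) :
    pgf P X z = ∑ k ∈ Finset.range (n + 1), (P.real (X ⁻¹' {k}) : ℂ) * z ^ k := by
  have hms : ∀ k, MeasurableSet (X ⁻¹' {k}) := fun k => hX (measurableSet_singleton k)
  have h1 : (fun ω => z ^ X ω) =ᵐ[P]
      fun ω => ∑ k ∈ Finset.range (n + 1), (X ⁻¹' {k}).indicator (fun _ => z ^ k) ω := by
    filter_upwards [hn] with ω hω
    rw [Finset.sum_eq_single (X ω)]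
    · simp
    · intro k _ hk
      simp [Set.indicator, hk.symm]
    · intro h
      simp at h
      omega
  rw [pgf, integral_congr_ae h1, integral_finsetSum]
  · refine Finset.sum_congr rfl fun k _ => ?_
    rw [integral_indicator_const _ (hms k)]
    simp
  · intro k _
    exact (integrable_const _).indicator (hms k)

theorem differentiable_pgf [IsProbabilityMeasure P] (hX : Measurable X)
    (hn : ∀ᵐ ω ∂P, X ω ≤ n) : Differentiable ℂ (pgf P X) := by
  have : pgf P X = fun z => ∑ k ∈ Finset.range (n + 1), (P.real (X ⁻¹' {k}) : ℂ) * z ^ k :=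
    funext (pgf_eq_sum hX hn)
  rw [this]
  fun_prop

theorem potential_conj [IsProbabilityMeasure P] (hX : Measurable X) (hn : ∀ᵐ ω ∂P, X ω ≤ n)
    (z : ℂ) : potential P X ((starRingEnd ℂ) z) = potential P X z := by
  have : pgf P X ((starRingEnd ℂ) z) = (starRingEnd ℂ) (pgf P X z) := by
    simp [pgf_eq_sum hX hn, map_sum]
  rw [potential, potential, this, Complex.norm_conj]

theorem pgf_one [IsProbabilityMeasure P] : pgf P X 1 = 1 := by
  simp [pgf]

theorem pgf_exp (w : ℂ) : pgf P X (exp w) = ∫ ω, exp (w * (X ω : ℂ)) ∂P := by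
  simp only [pgf]
  congr 1
  ext ω
  rw [← Complex.exp_nat_mul, mul_comm]

theorem pgf_exp_ofReal (t : ℝ) :
    pgf P X (exp t) = (mgf (fun ω => (X ω : ℝ)) P t : ℂ) := by
  rw [pgf_exp, mgf, ← integral_complex_ofReal]
  simp

theorem integrable_exp_mul_of_le [IsProbabilityMeasure P] (hX : Measurable X)
    (hn : ∀ᵐ ω ∂P, X ω ≤ n) (t : ℝ) : Integrable (fun ω => Real.exp (t * (X ω : ℝ))) P := by
  refine Integrable.of_bound (C := Real.exp (|t| * n)) ?_ ?_
  · have : Measurable fun ω => (X ω : ℝ) := measurable_from_top.comp hX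
    exact (by fun_prop : Measurable fun ω => Real.exp (t * (X ω : ℝ))).aestronglyMeasurable
  · filter_upwards [hn] with ω hω
    rw [Real.norm_eq_abs, Real.abs_exp]
    gcongr
    exact le_abs_self t

theorem memLp_two_of_le [IsProbabilityMeasure P] (hX : Measurable X)
    (hn : ∀ᵐ ω ∂P, X ω ≤ n) : MemLp (fun ω => (X ω : ℝ)) 2 P := by
  refine MemLp.of_bound (C := n) ?_ ?_
  · exact (measurable_from_top.comp hX : Measurable fun ω => (X ω : ℝ)).aestronglyMeasurable
  · filter_upwards [hn] with ω hω
    simpa using hω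

/-- Zeros of f_X are isolated because f_X(1) = 1, and log|f_X| tends to -∞ along punctured
neighbourhoods of a zero. This contradicts continuity there, whatever value the potential has at the
zero itself. -/
theorem pgf_ne_zero_of_harmonic [IsProbabilityMeasure P] (hX : Measurable X)
    (hn : ∀ᵐ ω ∂P, X ω ≤ n) {z : ℂ}
    (hz : InnerProductSpace.HarmonicAt (potential P X) z) : pgf P X z ≠ 0 := by
  intro h0
  have hd := differentiable_pgf hX hn
  have han : AnalyticOnNhd ℂ (pgf P X) Set.univ := fun w _ => hd.analyticAt w
  have hne : ∀ᶠ w in 𝓝[≠] z, pgf P X w ≠ 0 := by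
    rcases (hd.analyticAt z).eventually_eq_zero_or_eventually_ne_zero with h | h
    · have := han.eq_of_eventuallyEq (analyticOnNhd_const (v := (0 : ℂ))) h
      have h1 := congrFun this 1
      rw [pgf_one] at h1
      exact absurd h1 one_ne_zero
    · exact h
  have h1 : Tendsto (fun w => ‖pgf P X w‖) (𝓝[≠] z) (𝓝[≠] 0) := by
    refine tendsto_nhdsWithin_iff.2 ⟨?_, ?_⟩
    · have : ContinuousAt (fun w => ‖pgf P X w‖) z := hd.continuous.norm.continuousAt
      have h2 := this.tendsto
      rw [h0, norm_zero] at h2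
      exact h2.mono_left nhdsWithin_le_nhds
    · filter_upwards [hne] with w hw
      simpa using hw
  have h2 : Tendsto (potential P X) (𝓝[≠] z) atBot := Real.tendsto_log_nhdsNE_zero.comp h1
  have h3 : Tendsto (potential P X) (𝓝[≠] z) (𝓝 (potential P X z)) :=
    (hz.1.continuousAt.tendsto).mono_left nhdsWithin_le_nhds
  exact not_tendsto_nhds_of_tendsto_atBot h2 _ h3

/-- In the coordinate log z the angle is the imaginary part. The potential is invariant under
conjugation, so a point below the real axis may be reflected; this is why |Im v₁| appears. -/
theorem IsBDecreasingOn.potential_exp_sub_le [IsProbabilityMeasure P] (hX : Measurable X)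
    (hn : ∀ᵐ ω ∂P, X ω ≤ n) {b : ℝ} {D : Set ℂ} (h : IsBDecreasingOn b (potential P X) D)
    (hD : ∀ z ∈ D, (starRingEnd ℂ) z ∈ D) {v₁ v₂ : ℂ} (hre : v₁.re = v₂.re)
    (him : |v₁.im| ≤ v₂.im) (hpi : v₂.im ≤ Real.pi) (h₁ : exp v₁ ∈ D) (h₂ : exp v₂ ∈ D) :
    potential P X (exp v₂) - potential P X (exp v₁) ≤ b := by
  have e2 : exp v₂ = (Real.exp v₂.re : ℂ) * exp (v₂.im * I) := by
    rw [Complex.ofReal_exp, ← Complex.exp_add, Complex.re_add_im]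
  have e1 : potential P X (exp v₁)
        = potential P X ((Real.exp v₂.re : ℂ) * exp ((|v₁.im| : ℝ) * I)) ∧
      (Real.exp v₂.re : ℂ) * exp ((|v₁.im| : ℝ) * I) ∈ D := by
    rw [← hre, Complex.ofReal_exp, ← Complex.exp_add]
    rcases abs_choice v₁.im with ha | ha
    · rw [ha, Complex.re_add_im]
      exact ⟨rfl, h₁⟩
    · have : (v₁.re : ℂ) + (|v₁.im| : ℝ) * I = (starRingEnd ℂ) v₁ := by
        rw [ha]
        apply Complex.ext <;> simp
      rw [this, Complex.exp_conj]
      exact ⟨(potential_conj hX hn _).symm, hD _ h₁⟩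
  have := h (Real.exp v₂.re) |v₁.im| v₂.im (Real.exp_pos _) (abs_nonneg _) him hpi e1.2
    (e2 ▸ h₂)
  rw [e1.1, e2]
  linarith

end Pgf

/-- A nonvanishing holomorphic function on a disc has a holomorphic logarithm. -/
theorem exists_log_on_ball {F : ℂ → ℂ} {ρ : ℝ} (hF : DifferentiableOn ℂ F (ball 0 ρ))
    (h0 : ∀ w ∈ ball 0 ρ, F w ≠ 0) (h1 : F 0 = 1) :
    ∃ φ : ℂ → ℂ, DifferentiableOn ℂ φ (ball 0 ρ) ∧ φ 0 = 0 ∧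
      ∀ w ∈ ball 0 ρ, exp (φ w) = F w := by
  have hd : DifferentiableOn ℂ (fun w => deriv F w / F w) (ball 0 ρ) :=
    (hF.deriv isOpen_ball).div hF h0
  obtain ⟨φ, hφ0, hφ⟩ := hd.isExactOn_ball.with_val_at 0 0
  refine ⟨φ, fun w hw => (hφ w hw).differentiableAt.differentiableWithinAt, hφ0, fun w hw => ?_⟩
  -- φ is a primitive of F'/F, so F e^(-φ) has zero derivative and is constant.
  have hder : ∀ v ∈ ball (0 : ℂ) ρ, HasDerivAt (fun v => F v * exp (-φ v)) 0 v := by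
    intro v hv
    have hFv := (hF.differentiableAt (isOpen_ball.mem_nhds hv)).hasDerivAt
    have hz : deriv F v * exp (-φ v) + F v * (exp (-φ v) * -(deriv F v / F v)) = 0 := by
      have := h0 v hv
      field_simp
      ring
    rw [← hz]
    exact hFv.mul ((hφ v hv).neg.cexp)
  have hρ : (0 : ℂ) ∈ ball (0 : ℂ) ρ := by
    rw [mem_ball, dist_self]
    exact (dist_nonneg).trans_lt hw
  have := (convex_ball (0 : ℂ) ρ).is_const_of_fderivWithin_eq_zero (𝕜 := ℂ)
    (f := fun v => F v * exp (-φ v))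
    (fun v hv => (hder v hv).differentiableAt.differentiableWithinAt) (fun v hv => ?_) hw hρ
  · simp only [h1, hφ0, neg_zero, Complex.exp_zero, mul_one] at this
    rw [Complex.exp_neg] at this
    have he := Complex.exp_ne_zero (φ w)
    field_simp at this
    exact this.symm
  · rw [fderivWithin_of_isOpen isOpen_ball hv]
    ext
    simp [(hder v hv).deriv]

/-- Derivatives of a real function agree with those of a holomorphic extension. -/
theorem eventually_iteratedDeriv_ofReal {c : ℝ → ℝ} {φ : ℂ → ℂ} (hφ : AnalyticAt ℂ φ 0)
    (h : ∀ᶠ t : ℝ in 𝓝 0, (c t : ℂ) = φ t) (j : ℕ) :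
    ∀ᶠ t : ℝ in 𝓝 0, ((iteratedDeriv j c t : ℝ) : ℂ) = iteratedDeriv j φ t := by
  induction j with
  | zero => simpa using h
  | succ j ih =>
    have hev : ∀ᶠ t : ℝ in 𝓝 0, AnalyticAt ℂ φ t := by
      have : Tendsto (fun t : ℝ => (t : ℂ)) (𝓝 0) (𝓝 0) := by
        simpa using Complex.continuous_ofReal.tendsto 0
      exact this.eventually hφ.eventually_analyticAt
    filter_upwards [ih.eventually_nhds, hev] with t ht han
    have hd : HasDerivAt (iteratedDeriv j φ) (iteratedDeriv (j + 1) φ t) t := by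
      rw [iteratedDeriv_succ]
      exact (iteratedDeriv_eq_iterate (𝕜 := ℂ) (f := φ) ▸ han.iterated_deriv j).differentiableAt.hasDerivAt
    have h1 : HasDerivAt (fun s : ℝ => ((iteratedDeriv j c s : ℝ) : ℂ)) (iteratedDeriv (j + 1) φ t) t :=
      hd.comp_ofReal.congr_of_eventuallyEq ht
    have h2 : HasDerivAt (iteratedDeriv j c) (iteratedDeriv (j + 1) φ t).re t := by
      have := (Complex.reCLM.hasFDerivAt.comp_hasDerivAt t h1)
      simpa [Function.comp_def] using this
    rw [iteratedDeriv_succ, h2.deriv]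
    exact h2.ofReal_comp.unique h1

theorem conj_eq_of_iteratedDeriv_real {g : ℂ → ℂ} {ρ : ℝ} (hg : DifferentiableOn ℂ g (ball 0 ρ))
    (hr : ∀ k, (iteratedDeriv k g 0).im = 0) {w : ℂ} (hw : w ∈ ball 0 ρ) :
    g ((starRingEnd ℂ) w) = (starRingEnd ℂ) (g w) := by
  have hw' : (starRingEnd ℂ) w ∈ ball 0 ρ := by
    simpa [mem_ball_zero_iff] using hw
  have h1 := Complex.hasSum_taylorSeries_on_ball hg hw'
  have h2 := (Complex.hasSum_taylorSeries_on_ball hg hw).map (starRingEnd ℂ) Complex.continuous_conj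
  have e : ((starRingEnd ℂ) ∘ fun k => ((k.factorial : ℂ))⁻¹ • (w - 0) ^ k • iteratedDeriv k g 0)
      = fun k => ((k.factorial : ℂ))⁻¹ • ((starRingEnd ℂ) w - 0) ^ k • iteratedDeriv k g 0 := by
    funext k
    have hk : (starRingEnd ℂ) (iteratedDeriv k g 0) = iteratedDeriv k g 0 :=
      Complex.conj_eq_iff_im.2 (hr k)
    simp [hk]
  exact h1.unique (e ▸ h2)

theorem exists_log_pgf {Ω : Type*} [MeasurableSpace Ω] {P : Measure Ω} [IsProbabilityMeasure P]
    {X : Ω → ℕ} {n : ℕ} (hX : Measurable X) (hn : ∀ᵐ ω ∂P, X ω ≤ n) {ε : ℝ} (hε : 0 < ε)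
    (hε1 : ε < 1) (hh : InnerProductSpace.HarmonicOnNhd (potential P X) (ball 1 ε)) :
    ∃ φ : ℂ → ℂ, DifferentiableOn ℂ φ (ball 0 (ε / 2)) ∧ φ 0 = 0 ∧
      (∀ w ∈ ball 0 (ε / 2), exp w ∈ ball 1 ε ∧ exp (φ w) = pgf P X (exp w)) ∧
      ∀ j, iteratedDeriv j φ 0 = (cumulant P (fun ω => (X ω : ℝ)) j : ℂ) := by
  have hexp : ∀ w ∈ ball (0 : ℂ) (ε / 2), exp w ∈ ball (1 : ℂ) ε := by
    intro w hw
    rw [mem_ball_zero_iff] at hw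
    rw [mem_ball, dist_eq_norm]
    have := Complex.norm_exp_sub_one_le (x := w) (by linarith)
    linarith
  have hd := differentiable_pgf hX hn
  obtain ⟨φ, hφ, hφ0, hφe⟩ := exists_log_on_ball (F := fun w => pgf P X (exp w)) (ρ := ε / 2)
    (hd.comp Complex.differentiable_exp).differentiableOn
    (fun w hw => pgf_ne_zero_of_harmonic hX hn (hh _ (hexp w hw))) (by simp [pgf_one])
  refine ⟨φ, hφ, hφ0, fun w hw => ⟨hexp w hw, hφe w hw⟩, fun j => ?_⟩
  have han : AnalyticAt ℂ φ 0 := hφ.analyticAt (ball_mem_nhds 0 (by linarith))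
  have hev : ∀ᶠ t : ℝ in 𝓝 0, (cgf (fun ω => (X ω : ℝ)) P t : ℂ) = φ t := by
    have ht : Tendsto (fun t : ℝ => (t : ℂ)) (𝓝 0) (𝓝 0) := by
      simpa using Complex.continuous_ofReal.tendsto 0
    -- Near 0 the values of φ lie in the strip where the principal logarithm inverts exp, so log of
    -- the moment generating function is φ itself and not φ plus a multiple of 2πi.
    have h1 : ∀ᶠ w in 𝓝 (0 : ℂ), |(φ w).im| < Real.pi := by
      have hc : ContinuousAt (fun w => |(φ w).im|) 0 :=
        (Complex.continuous_im.continuousAt.comp han.continuousAt).abs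
      refine hc.eventually_lt continuousAt_const ?_
      simpa [hφ0] using Real.pi_pos
    filter_upwards [ht.eventually h1, ht.eventually (ball_mem_nhds (0 : ℂ) (half_pos hε))]
      with t ht1 ht2
    have := hφe t ht2
    rw [pgf_exp_ofReal] at this
    rw [cgf, Complex.ofReal_log mgf_nonneg, ← this,
      Complex.log_exp (neg_lt_of_abs_lt ht1) (le_of_lt (lt_of_abs_lt ht1))]
  have := (eventually_iteratedDeriv_ofReal han hev j).self_of_nhds
  rw [cumulant]
  simpa using this.symm

theorem cumulant_one_two {Ω : Type*} [MeasurableSpace Ω] {P : Measure Ω} [IsProbabilityMeasure P]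
    {X : Ω → ℕ} {n : ℕ} (hX : Measurable X) (hn : ∀ᵐ ω ∂P, X ω ≤ n) :
    cumulant P (fun ω => (X ω : ℝ)) 1 = ∫ ω, (X ω : ℝ) ∂P ∧
    cumulant P (fun ω => (X ω : ℝ)) 2 = stdDev P X ^ 2 := by
  have h0 : (0 : ℝ) ∈ interior (integrableExpSet (fun ω => (X ω : ℝ)) P) := by
    have : integrableExpSet (fun ω => (X ω : ℝ)) P = Set.univ :=
      Set.eq_univ_of_forall fun t => integrable_exp_mul_of_le hX hn t
    simp [this]
  have h1 := deriv_cgf_zero h0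
  simp only [probReal_univ, div_one] at h1
  refine ⟨by rw [cumulant, iteratedDeriv_one, h1], ?_⟩
  rw [cumulant, iteratedDeriv_two_cgf_eq_integral h0, h1, stdDev, Real.sq_sqrt (variance_nonneg _ _),
    variance_eq_integral (memLp_two_of_le hX hn).aemeasurable]
  simp

end LogPotential

end

/-! ### The Fejér kernel and removal of smoothing. -/

noncomputable section

namespace LogPotential

open Set Filter Topology

/-- The (unnormalized) Fejér kernel, the Fourier transform of `s ↦ max (1 - |s|) 0`. -/
def fejerKernel (v : ℝ) : ℝ := 2 * (1 - Real.cos v) / v ^ 2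

theorem fejerKernel_nonneg (v : ℝ) : 0 ≤ fejerKernel v :=
  div_nonneg (by linarith [Real.cos_le_one v]) (sq_nonneg v)

theorem fejerKernel_neg (v : ℝ) : fejerKernel (-v) = fejerKernel v := by
  simp [fejerKernel]

theorem fejerKernel_le (v : ℝ) : fejerKernel v ≤ 4 * (v ^ 2)⁻¹ := by
  rw [fejerKernel, div_eq_mul_inv]
  gcongr
  linarith [Real.neg_one_le_cos v]

theorem fejerKernel_le_one (v : ℝ) : fejerKernel v ≤ 1 := by
  rw [fejerKernel]
  refine div_le_one_of_le₀ ?_ (sq_nonneg v)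
  linarith [Real.one_sub_sq_div_two_le_cos (x := v)]

theorem measurable_fejerKernel : Measurable fejerKernel := by
  unfold fejerKernel
  fun_prop

theorem integrable_fejerKernel : Integrable fejerKernel := by
  refine (integrable_inv_one_add_sq.const_mul 5).mono'
    measurable_fejerKernel.aestronglyMeasurable (ae_of_all _ fun v => ?_)
  rw [Real.norm_eq_abs, abs_of_nonneg (fejerKernel_nonneg v), ← div_eq_mul_inv,
    le_div_iff₀ (by positivity)]
  have h1 := fejerKernel_le_one v
  have h2 : fejerKernel v * v ^ 2 ≤ 4 := by
    rcases eq_or_ne v 0 with rfl | hv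
    · simp
    · have := fejerKernel_le v
      rwa [← div_eq_mul_inv, le_div_iff₀ (by positivity)] at this
  linarith

/-- The cut at 8 makes the inner mass at least twice the outer mass (at most 1), which the
self-improving step of `abs_sub_le_of_fejerKernel` needs. The lower bound 4/π² on [-π, π] already
gives mass 8/π > 2. -/
theorem two_le_setIntegral_fejerKernel : 2 ≤ ∫ v in Icc (-8 : ℝ) 8, fejerKernel v := by
  have hp := Real.pi_pos
  have hp4 := Real.pi_lt_four
  have h1 : ∫ v in Icc (-Real.pi) Real.pi, (4 / Real.pi ^ 2 : ℝ)
      ≤ ∫ v in Icc (-Real.pi) Real.pi, fejerKernel v := by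
    refine setIntegral_mono_on_ae (by simp) integrable_fejerKernel.integrableOn
      measurableSet_Icc ?_
    -- At v = 0 the defining quotient is 0/0 = 0 instead of the limit 1, so the origin is discarded
    -- as a null set.
    filter_upwards [Measure.ae_ne volume (0 : ℝ)] with v hv0 hv
    have hv2 : 0 < v ^ 2 := by positivity
    have := Real.cos_le_one_sub_mul_cos_sq (abs_le.2 hv)
    rw [fejerKernel, le_div_iff₀ hv2]
    calc 4 / Real.pi ^ 2 * v ^ 2 = 2 * (2 / Real.pi ^ 2 * v ^ 2) := by ring
      _ ≤ _ := by linarith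
  have h2 : ∫ v in Icc (-Real.pi) Real.pi, fejerKernel v ≤ ∫ v in Icc (-8 : ℝ) 8, fejerKernel v := by
    refine setIntegral_mono_set integrable_fejerKernel.integrableOn
      (ae_of_all _ fejerKernel_nonneg) ?_
    exact (Icc_subset_Icc (by linarith) (by linarith)).eventuallyLE
  refine le_trans ?_ (h1.trans h2)
  rw [setIntegral_const, Real.volume_real_Icc_of_le (by linarith), smul_eq_mul]
  have : (Real.pi - -Real.pi) * (4 / Real.pi ^ 2) = 8 / Real.pi := by field_simp; ring
  rw [this, le_div_iff₀ hp]
  linarith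

theorem setIntegral_compl_fejerKernel_le : ∫ v in (Icc (-8 : ℝ) 8)ᶜ, fejerKernel v ≤ 1 := by
  have hi := integrable_fejerKernel
  have hs : (Icc (-8 : ℝ) 8)ᶜ = Iio (-8) ∪ Ioi 8 := by
    ext v
    simp only [mem_compl_iff, mem_Icc, not_and_or, not_le, mem_union, mem_Iio, mem_Ioi]
  have h1 : ∫ v in Ioi (8 : ℝ), fejerKernel v ≤ 1 / 2 := by
    have hr := integrableOn_Ioi_rpow_of_lt (a := -2) (by norm_num) (by norm_num : (0 : ℝ) < 8)
    have hv := integral_Ioi_rpow_of_lt (a := -2) (by norm_num) (by norm_num : (0 : ℝ) < 8)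
    calc ∫ v in Ioi (8 : ℝ), fejerKernel v ≤ ∫ v in Ioi (8 : ℝ), 4 * v ^ (-2 : ℝ) := by
          refine setIntegral_mono_on hi.integrableOn (hr.const_mul 4) measurableSet_Ioi
            fun v hv => ?_
          have : v ^ (-2 : ℝ) = (v ^ 2)⁻¹ := by
            rw [Real.rpow_neg (le_of_lt (lt_trans (by norm_num) hv))]
            norm_num
          rw [this]
          exact fejerKernel_le v
      _ = 1 / 2 := by
          rw [integral_const_mul, hv]
          norm_num [Real.rpow_neg_one]
  have h2 : ∫ v in Iio (-8 : ℝ), fejerKernel v = ∫ v in Ioi (8 : ℝ), fejerKernel v := by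
    rw [← integral_Iic_eq_integral_Iio, ← integral_comp_neg_Ioi]
    simp_rw [fejerKernel_neg]
  rw [hs, setIntegral_union (by
      refine Set.disjoint_left.2 fun v h3 h4 => ?_
      simp only [mem_Iio, mem_Ioi] at h3 h4
      linarith) measurableSet_Ioi hi.integrableOn hi.integrableOn, h2]
  linarith

/-- Removing the smoothing by the Fejér kernel from a bound for the difference of two distribution
functions. -/
theorem abs_sub_le_of_fejerKernel {F G : ℝ → ℝ} {L δ : ℝ} (hF : Monotone F) (hG : Monotone G)
    (hF0 : ∀ x, F x ∈ Icc (0 : ℝ) 1) (hG0 : ∀ x, G x ∈ Icc (0 : ℝ) 1)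
    (hL : ∀ x y, x ≤ y → G y - G x ≤ L * (y - x))
    (hδ : ∀ a, |∫ v, fejerKernel v * (F (a - v) - G (a - v))| ≤ δ) (x : ℝ) :
    |F x - G x| ≤ 32 * L + δ := by
  have hi := integrable_fejerKernel
  have hA := two_le_setIntegral_fejerKernel
  have hB := setIntegral_compl_fejerKernel_le
  have hB0 : 0 ≤ ∫ v in (Icc (-8 : ℝ) 8)ᶜ, fejerKernel v :=
    integral_nonneg fejerKernel_nonneg
  have hΔ1 : ∀ x, |F x - G x| ≤ 1 := fun x => by
    rw [abs_le]
    constructor <;> linarith [(hF0 x).1, (hF0 x).2, (hG0 x).1, (hG0 x).2]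
  have hint : ∀ a, Integrable fun v => fejerKernel v * (F (a - v) - G (a - v)) := fun a => by
    refine hi.mul_bdd (c := 1) ?_ (ae_of_all _ fun v => hΔ1 _)
    have hm : Measurable fun v : ℝ => a - v := by fun_prop
    exact ((hF.measurable.comp hm).sub (hG.measurable.comp hm)).aestronglyMeasurable
  -- Any uniform bound e improves to 16L + (δ + e)/2; taking e to be the supremum gives e ≤ 32L + δ.
  have hstep : ∀ e, (∀ x, |F x - G x| ≤ e) → ∀ x, |F x - G x| ≤ 16 * L + (δ + e) / 2 := by
    intro e he x
    have he0 : 0 ≤ e := (abs_nonneg _).trans (he 0)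
    have hδ0 : 0 ≤ δ := (abs_nonneg _).trans (hδ 0)
    have hsplit : ∀ a, ∫ v, fejerKernel v * (F (a - v) - G (a - v))
        = (∫ v in Icc (-8 : ℝ) 8, fejerKernel v * (F (a - v) - G (a - v)))
          + ∫ v in (Icc (-8 : ℝ) 8)ᶜ, fejerKernel v * (F (a - v) - G (a - v)) := fun a =>
      (integral_add_compl measurableSet_Icc (hint a)).symm
    have htail : ∀ a, |∫ v in (Icc (-8 : ℝ) 8)ᶜ, fejerKernel v * (F (a - v) - G (a - v))|
        ≤ (∫ v in (Icc (-8 : ℝ) 8)ᶜ, fejerKernel v) * e := by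
      intro a
      refine abs_integral_le_integral_abs.trans ?_
      rw [← integral_mul_const]
      refine integral_mono (hint a).integrableOn.abs (hi.integrableOn.mul_const e) fun v => ?_
      simp only [abs_mul, abs_of_nonneg (fejerKernel_nonneg v)]
      exact mul_le_mul_of_nonneg_left (he _) (fejerKernel_nonneg v)
    -- Centring at x + 8 puts the whole window in [x, x + 16]: there F is at least F(x), and G
    -- exceeds G(x) by at most 16L. The upper estimate centres at x - 8.
    have hlow : (∫ v in Icc (-8 : ℝ) 8, fejerKernel v) * (F x - G x - 16 * L)
        ≤ ∫ v in Icc (-8 : ℝ) 8, fejerKernel v * (F (x + 8 - v) - G (x + 8 - v)) := by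
      rw [← integral_mul_const]
      refine setIntegral_mono_on (hi.integrableOn.mul_const _) (hint _).integrableOn
        measurableSet_Icc fun v hv => ?_
      refine mul_le_mul_of_nonneg_left ?_ (fejerKernel_nonneg v)
      have h1 := hF (show x ≤ x + 8 - v by linarith [hv.2])
      have h2 := hG (show x + 8 - v ≤ x + 16 by linarith [hv.1])
      have h3 := hL x (x + 16) (by linarith)
      linarith
    have hupp : ∫ v in Icc (-8 : ℝ) 8, fejerKernel v * (F (x - 8 - v) - G (x - 8 - v))
        ≤ (∫ v in Icc (-8 : ℝ) 8, fejerKernel v) * (F x - G x + 16 * L) := by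
      rw [← integral_mul_const]
      refine setIntegral_mono_on (hint _).integrableOn (hi.integrableOn.mul_const _)
        measurableSet_Icc fun v hv => ?_
      refine mul_le_mul_of_nonneg_left ?_ (fejerKernel_nonneg v)
      have h1 := hF (show x - 8 - v ≤ x by linarith [hv.1])
      have h2 := hG (show x - 16 ≤ x - 8 - v by linarith [hv.2])
      have h3 := hL (x - 16) x (by linarith)
      linarith
    have hd1 := abs_le.1 (hδ (x + 8))
    have hd2 := abs_le.1 (hδ (x - 8))
    rw [hsplit] at hd1 hd2
    have ht1 := abs_le.1 (htail (x + 8))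
    have ht2 := abs_le.1 (htail (x - 8))
    have hBe : (∫ v in (Icc (-8 : ℝ) 8)ᶜ, fejerKernel v) * e ≤ e := by nlinarith
    rw [abs_le]
    constructor
    · by_contra! hc
      nlinarith
    · by_contra! hc
      nlinarith
  have hbdd : BddAbove (range fun x => |F x - G x|) := ⟨1, by rintro _ ⟨x, rfl⟩; exact hΔ1 x⟩
  have h1 := ciSup_le (hstep (⨆ x, |F x - G x|) fun x => le_ciSup hbdd x)
  have h2 := le_ciSup hbdd x
  linarith

open Complex in
theorem fejerKernel_eq_integral {v : ℝ} (hv : v ≠ 0) :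
    (fejerKernel v : ℂ) = ∫ s in (-1 : ℝ)..1, (1 - |s| : ℝ) * exp (s * v * I) := by
  have hvc : (v : ℂ) ≠ 0 := by exact_mod_cast hv
  have hint : ∀ a b : ℝ, IntervalIntegrable
      (fun s : ℝ => ((1 - |s| : ℝ) : ℂ) * exp (s * v * I)) volume a b :=
    fun a b => Continuous.intervalIntegrable (by fun_prop) _ _
  have hpos : ∀ u : ℝ, u ≠ 0 → ∫ s in (0 : ℝ)..1, ((1 - s : ℝ) : ℂ) * exp (s * u * I)
      = -(exp (u * I) - 1) / u ^ 2 + I / u := by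
    intro u hu
    have huc : (u : ℂ) ≠ 0 := by exact_mod_cast hu
    have hd : ∀ s : ℝ, HasDerivAt
        (fun s : ℝ => (1 - s : ℂ) * (exp (s * u * I) / (u * I)) + exp (s * u * I) / (u * I) ^ 2)
        (((1 - s : ℝ) : ℂ) * exp (s * u * I)) s := by
      intro s
      have h1 : HasDerivAt (fun z : ℂ => exp (z * u * I)) (exp (s * u * I) * (u * I)) s := by
        have h0 : HasDerivAt (fun z : ℂ => z * u * I) (u * I) s := by
          simpa [mul_assoc] using (hasDerivAt_id (s : ℂ)).mul_const (u * I : ℂ)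
        exact h0.cexp
      have h2 : HasDerivAt (fun z : ℂ => 1 - z) (-1) s := by
        simpa using (hasDerivAt_id (s : ℂ)).const_sub 1
      have h3 := ((h2.mul (h1.div_const (u * I))).add (h1.div_const ((u * I) ^ 2))).comp_ofReal
      have e : -1 * (exp (s * u * I) / (u * I)) + (1 - s) * (exp (s * u * I) * (u * I) / (u * I))
          + exp (s * u * I) * (u * I) / (u * I) ^ 2 = ((1 - s : ℝ) : ℂ) * exp (s * u * I) := by
        have := I_ne_zero
        push_cast
        field_simp
        ring
      rw [← e]
      exact h3
    rw [intervalIntegral.integral_eq_sub_of_hasDerivAt (fun s _ => hd s)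
      (Continuous.intervalIntegrable (by fun_prop) _ _)]
    simp only [ofReal_one, sub_self, zero_mul, one_mul, ofReal_zero, exp_zero, sub_zero, zero_add,
      mul_pow, I_sq]
    have := I_ne_zero
    have h5 : I ^ 2 = -1 := I_sq
    field_simp
    linear_combination (-(u : ℂ)) * h5
  have h1 : ∫ s in (0 : ℝ)..1, ((1 - |s| : ℝ) : ℂ) * exp (s * v * I)
      = ∫ s in (0 : ℝ)..1, ((1 - s : ℝ) : ℂ) * exp (s * v * I) := by
    refine intervalIntegral.integral_congr fun s hs => ?_
    rw [uIcc_of_le zero_le_one] at hs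
    simp only [abs_of_nonneg hs.1]
  have h2 : ∫ s in (-1 : ℝ)..0, ((1 - |s| : ℝ) : ℂ) * exp (s * v * I)
      = ∫ s in (0 : ℝ)..1, ((1 - s : ℝ) : ℂ) * exp (s * (-v : ℝ) * I) := by
    have := intervalIntegral.integral_comp_neg (a := 0) (b := 1)
      (fun s : ℝ => ((1 - |s| : ℝ) : ℂ) * exp (s * v * I))
    rw [neg_zero] at this
    rw [← this]
    refine intervalIntegral.integral_congr fun s hs => ?_
    rw [uIcc_of_le zero_le_one] at hs
    simp only [abs_neg, abs_of_nonneg hs.1]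
    push_cast
    ring_nf
  rw [← intervalIntegral.integral_add_adjacent_intervals (hint (-1) 0) (hint 0 1), h1, h2,
    hpos v hv, hpos (-v) (neg_ne_zero.2 hv), fejerKernel]
  push_cast
  rw [Complex.cos]
  field_simp
  ring

end LogPotential

end

/-! ### The Esseen smoothing inequality. -/

noncomputable section

namespace LogPotential

open Set Filter Topology

/-- The quotient `(e^{isx} - 1) / (is)`, the integral of `v ↦ e^{isv}` over `[0, x]`. -/
def expQuotient (s x : ℝ) : ℂ := (Complex.exp (Complex.I * (s * x : ℝ)) - 1) / (s * Complex.I)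

theorem measurable_expQuotient : Measurable fun p : ℝ × ℝ => expQuotient p.1 p.2 := by
  unfold expQuotient
  fun_prop

theorem norm_expQuotient_le (s x : ℝ) : ‖expQuotient s x‖ ≤ |x| := by
  rw [expQuotient, norm_div, norm_mul, Complex.norm_I, mul_one, Complex.norm_real,
    Real.norm_eq_abs]
  refine div_le_of_le_mul₀ (abs_nonneg _) (abs_nonneg _) ?_
  refine Real.norm_exp_I_mul_ofReal_sub_one_le.trans ?_
  rw [Real.norm_eq_abs, abs_mul, mul_comm]

theorem integral_fejerKernel_eq (x : ℝ) :
    ((∫ v in (0 : ℝ)..x, fejerKernel v : ℝ) : ℂ)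
      = ∫ s in (-1 : ℝ)..1, (1 - |s| : ℝ) * expQuotient s x := by
  have h1 : ((∫ v in (0 : ℝ)..x, fejerKernel v : ℝ) : ℂ) = ∫ v in (0 : ℝ)..x,
      ∫ s in (-1 : ℝ)..1, ((1 - |s| : ℝ) : ℂ) * Complex.exp (s * v * Complex.I) := by
    rw [← intervalIntegral.integral_ofReal]
    refine intervalIntegral.integral_congr_ae ?_
    filter_upwards [Measure.ae_ne volume (0 : ℝ)] with v hv0 _
    exact fejerKernel_eq_integral hv0
  have h2 : ∫ v in (0 : ℝ)..x,
      ∫ s in (-1 : ℝ)..1, ((1 - |s| : ℝ) : ℂ) * Complex.exp (s * v * Complex.I)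
      = ∫ s in (-1 : ℝ)..1,
      ∫ v in (0 : ℝ)..x, ((1 - |s| : ℝ) : ℂ) * Complex.exp (s * v * Complex.I) := by
    have hint : Integrable (Function.uncurry fun s v : ℝ =>
        ((1 - |s| : ℝ) : ℂ) * Complex.exp (s * v * Complex.I))
        ((volume.restrict (uIoc (-1) 1)).prod (volume.restrict (uIoc 0 x))) := by
      rw [Measure.prod_restrict, ← Measure.volume_eq_prod]
      refine IntegrableOn.mono_set (t := uIcc (-1) 1 ×ˢ uIcc 0 x) ?_
        (prod_mono uIoc_subset_uIcc uIoc_subset_uIcc)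
      refine ContinuousOn.integrableOn_compact (isCompact_uIcc.prod isCompact_uIcc) ?_
      exact Continuous.continuousOn (by simp only [Function.uncurry_def]; fun_prop)
    have h3 := intervalIntegral_integral_swap hint
    simp only [intervalIntegral.intervalIntegral_eq_integral_uIoc _ 0 x]
    rw [intervalIntegral.integral_smul, h3]
  rw [h1, h2]
  refine intervalIntegral.integral_congr_ae ?_
  filter_upwards [Measure.ae_ne volume (0 : ℝ)] with s hs0 _
  rw [intervalIntegral.integral_const_mul]
  congr 1
  have hsc : (s : ℂ) * Complex.I ≠ 0 := by
    simpa using hs0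
  have := integral_exp_mul_complex (a := 0) (b := x) hsc
  rw [expQuotient]
  simp only [Complex.ofReal_zero, mul_zero, Complex.exp_zero] at this
  rw [show Complex.I * ((s * x : ℝ) : ℂ) = s * Complex.I * x by push_cast; ring, ← this]
  refine intervalIntegral.integral_congr fun v _ => ?_
  ring_nf

section

variable (ν : Measure ℝ) [IsProbabilityMeasure ν]

/-- The integrand is dominated by |a - x|, so the factor 1/s does no harm. The finite first moment
of ν enters here. -/
theorem integrable_expQuotient_prod (hν : Integrable id ν) (a : ℝ) :
    Integrable (Function.uncurry fun s x : ℝ => ((1 - |s| : ℝ) : ℂ) * expQuotient s (a - x))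
      ((volume.restrict (uIoc (-1) 1)).prod ν) := by
  have hdom : Integrable (fun p : ℝ × ℝ => |a - p.2|)
      ((volume.restrict (uIoc (-1 : ℝ) 1)).prod ν) := by
    have h0 : Integrable (fun x : ℝ => |a - x|) ν := ((integrable_const a).sub hν).abs
    have : IsFiniteMeasure (volume.restrict (uIoc (-1 : ℝ) 1)) := by
      rw [uIoc_of_le (by norm_num)]
      infer_instance
    exact h0.comp_snd _
  refine hdom.mono' ?_ ?_
  · refine Measurable.aestronglyMeasurable ?_
    have hm : Measurable fun p : ℝ × ℝ => (p.1, a - p.2) := by fun_prop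
    have := measurable_expQuotient.comp hm
    simp only [Function.comp_def] at this
    simp only [Function.uncurry_def]
    fun_prop
  · have hs : ∀ᵐ p : ℝ × ℝ ∂((volume.restrict (uIoc (-1 : ℝ) 1)).prod ν), p.1 ∈ uIoc (-1 : ℝ) 1 :=
      Measure.quasiMeasurePreserving_fst.ae (ae_restrict_mem measurableSet_uIoc)
    filter_upwards [hs] with p hp
    rw [uIoc_of_le (by norm_num)] at hp
    have h1 : |p.1| ≤ 1 := abs_le.2 ⟨hp.1.le, hp.2⟩
    simp only [Function.uncurry_def, norm_mul, Complex.norm_real, Real.norm_eq_abs]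
    calc _ ≤ 1 * |a - p.2| := by
          gcongr
          · rw [abs_of_nonneg (by linarith)]
            linarith [abs_nonneg p.1]
          · exact norm_expQuotient_le _ _
      _ = _ := one_mul _

theorem integral_expQuotient (a s : ℝ) :
    ∫ x, expQuotient s (a - x) ∂ν
      = (Complex.exp (Complex.I * (s * a : ℝ)) * charFun ν (-s) - 1) / (s * Complex.I) := by
  have h : ∀ x : ℝ, expQuotient s (a - x) = (Complex.exp (Complex.I * (s * a : ℝ)) *
      Complex.exp ((-s : ℝ) * x * Complex.I) - 1) / (s * Complex.I) := by
    intro x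
    rw [expQuotient, ← Complex.exp_add]
    congr 3
    push_cast
    ring
  have hi : Integrable (fun x : ℝ => Complex.exp ((-s : ℝ) * x * Complex.I)) ν := by
    refine Integrable.of_bound (C := 1) (by fun_prop) (ae_of_all _ fun x => ?_)
    rw [← Complex.ofReal_mul, Complex.norm_exp_ofReal_mul_I]
  simp_rw [h]
  rw [integral_div, integral_sub (hi.const_mul _) (integrable_const _), integral_const_mul,
    charFun_apply_real]
  simp

theorem integral_integral_fejerKernel (hν : Integrable id ν) (a : ℝ) :
    ((∫ x, (∫ v in (0 : ℝ)..(a - x), fejerKernel v) ∂ν : ℝ) : ℂ)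
      = ∫ s in (-1 : ℝ)..1, (1 - |s| : ℝ) *
        ((Complex.exp (Complex.I * (s * a : ℝ)) * charFun ν (-s) - 1) / (s * Complex.I)) := by
  rw [← integral_complex_ofReal]
  simp_rw [integral_fejerKernel_eq]
  rw [← intervalIntegral_integral_swap (integrable_expQuotient_prod ν hν a)]
  refine intervalIntegral.integral_congr fun s _ => ?_
  rw [integral_const_mul, integral_expQuotient]

theorem intervalIntegrable_expQuotient (hν : Integrable id ν) (a : ℝ) :
    IntervalIntegrable (fun s : ℝ => ((1 - |s| : ℝ) : ℂ) *
        ((Complex.exp (Complex.I * (s * a : ℝ)) * charFun ν (-s) - 1) / (s * Complex.I)))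
      volume (-1) 1 := by
  rw [intervalIntegrable_iff]
  have := (integrable_expQuotient_prod ν hν a).integral_prod_left
  refine this.congr (ae_of_all _ fun s => ?_)
  simp only [Function.uncurry_def]
  rw [integral_const_mul, integral_expQuotient]

/-- Fubini isolates a constant independent of ν, which cancels when two laws are compared; the other
term has a Fourier expression. -/
theorem integral_fejerKernel_mul_real (a : ℝ) :
    ∫ v, fejerKernel v * ν.real (Iic (a - v))
      = (∫ v in Iic (0 : ℝ), fejerKernel v)
        + ∫ x, (∫ v in (0 : ℝ)..(a - x), fejerKernel v) ∂ν := by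
  have hi := integrable_fejerKernel
  set S : Set (ℝ × ℝ) := {p | p.1 + p.2 ≤ a} with hS
  have hSm : MeasurableSet S := measurableSet_le (by fun_prop) measurable_const
  have hint : Integrable (Function.uncurry fun v x : ℝ => S.indicator
      (fun p : ℝ × ℝ => fejerKernel p.1) (v, x)) (volume.prod ν) := by
    have h0 : Integrable (fun p : ℝ × ℝ => fejerKernel p.1) (volume.prod ν) := hi.comp_fst ν
    exact h0.indicator hSm
  have hswap := integral_integral_swap hint
  have hl : ∀ v, ∫ x, S.indicator (fun p : ℝ × ℝ => fejerKernel p.1) (v, x) ∂ν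
      = fejerKernel v * ν.real (Iic (a - v)) := by
    intro v
    have : (fun x => S.indicator (fun p : ℝ × ℝ => fejerKernel p.1) (v, x))
        = (Iic (a - v)).indicator fun _ => fejerKernel v := by
      ext x
      simp only [indicator, hS, mem_ofPred_eq, mem_Iic, le_sub_iff_add_le']
    rw [this, integral_indicator_const _ measurableSet_Iic, smul_eq_mul, mul_comm]
  have hr : ∀ x, ∫ v, S.indicator (fun p : ℝ × ℝ => fejerKernel p.1) (v, x)
      = (∫ v in Iic (0 : ℝ), fejerKernel v) + ∫ v in (0 : ℝ)..(a - x), fejerKernel v := by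
    intro x
    have : (fun v => S.indicator (fun p : ℝ × ℝ => fejerKernel p.1) (v, x))
        = (Iic (a - x)).indicator fejerKernel := by
      ext v
      simp only [indicator, hS, mem_ofPred_eq, mem_Iic, le_sub_iff_add_le]
    rw [this, integral_indicator measurableSet_Iic,
      ← intervalIntegral.integral_Iic_sub_Iic hi.integrableOn hi.integrableOn]
    ring
  simp_rw [hl, hr] at hswap
  have hK : Integrable (fun x => ∫ v in (0 : ℝ)..(a - x), fejerKernel v) ν := by
    have h1 := hint.integral_prod_right
    simp only [Function.uncurry_def] at h1
    simp_rw [hr] at h1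
    refine (h1.sub (integrable_const (∫ v in Iic (0 : ℝ), fejerKernel v))).congr
      (ae_of_all _ fun x => ?_)
    simp only [Pi.sub_apply, add_sub_cancel_left]
  rw [hswap, integral_add (integrable_const _) hK]
  simp

end

/-- The smoothing inequality: closeness of characteristic functions on `[-1, 1]` gives closeness of
distribution functions, when one of them is Lipschitz. -/
theorem abs_real_Iic_sub_le {ν γ : Measure ℝ} [IsProbabilityMeasure ν] [IsProbabilityMeasure γ]
    (hν : Integrable id ν) (hγ : Integrable id γ) {L : ℝ} {M : ℝ → ℝ}
    (hL : ∀ x y, x ≤ y → γ.real (Iic y) - γ.real (Iic x) ≤ L * (y - x))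
    (hM : IntervalIntegrable M volume (-1) 1)
    (h : ∀ s : ℝ, |s| ≤ 1 → ‖charFun ν s - charFun γ s‖ ≤ M s * |s|) (x : ℝ) :
    |ν.real (Iic x) - γ.real (Iic x)| ≤ 32 * L + ∫ s in (-1 : ℝ)..1, M s := by
  have hmono : ∀ (ρ : Measure ℝ) [IsProbabilityMeasure ρ], Monotone fun x => ρ.real (Iic x) :=
    fun ρ _ x y hxy => measureReal_mono (Iic_subset_Iic.2 hxy)
  refine abs_sub_le_of_fejerKernel (F := fun x => ν.real (Iic x)) (G := fun x => γ.real (Iic x))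
    (hmono ν) (hmono γ) (fun x => ⟨measureReal_nonneg, measureReal_le_one⟩)
    (fun x => ⟨measureReal_nonneg, measureReal_le_one⟩) hL (fun a => ?_) x
  have hi : ∀ (ρ : Measure ℝ) [IsProbabilityMeasure ρ],
      Integrable fun v => fejerKernel v * ρ.real (Iic (a - v)) := fun ρ _ => by
    refine integrable_fejerKernel.mul_bdd (c := 1) ?_ (ae_of_all _ fun v => ?_)
    · exact ((hmono ρ).measurable.comp
        (by fun_prop : Measurable fun v : ℝ => a - v)).aestronglyMeasurable
    · rw [Real.norm_eq_abs, abs_of_nonneg measureReal_nonneg]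
      exact measureReal_le_one
  simp_rw [mul_sub]
  rw [integral_sub (hi ν) (hi γ), integral_fejerKernel_mul_real ν,
    integral_fejerKernel_mul_real γ, add_sub_add_left_eq_sub, ← Real.norm_eq_abs,
    ← Complex.norm_real, Complex.ofReal_sub, integral_integral_fejerKernel ν hν,
    integral_integral_fejerKernel γ hγ, ← intervalIntegral.integral_sub
      (intervalIntegrable_expQuotient ν hν a) (intervalIntegrable_expQuotient γ hγ a)]
  have hneg := intervalIntegral.integral_comp_neg (a := -1) (b := 1) M
  rw [neg_neg] at hneg
  rw [← hneg]
  have hM' : IntervalIntegrable (fun s => M (-s)) volume (-1) 1 := by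
    have := (IntervalIntegrable.iff_comp_neg).1 hM
    simp only [neg_neg] at this
    exact this.symm
  refine intervalIntegral.norm_integral_le_of_norm_le (by norm_num) ?_ hM'
  filter_upwards [Measure.ae_ne volume (0 : ℝ)] with s hs0 hs
  have h1 : |s| ≤ 1 := abs_le.2 ⟨hs.1.le, hs.2⟩
  have hspos : 0 < |s| := abs_pos.2 hs0
  have e : ((1 - |s| : ℝ) : ℂ) *
        ((Complex.exp (Complex.I * (s * a : ℝ)) * charFun ν (-s) - 1) / (s * Complex.I))
      - ((1 - |s| : ℝ) : ℂ) *
        ((Complex.exp (Complex.I * (s * a : ℝ)) * charFun γ (-s) - 1) / (s * Complex.I))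
      = ((1 - |s| : ℝ) : ℂ) * (Complex.exp (Complex.I * (s * a : ℝ)) *
        (charFun ν (-s) - charFun γ (-s)) / (s * Complex.I)) := by
    ring
  have h2 := h (-s) (by rwa [abs_neg])
  rw [abs_neg] at h2
  rw [e, norm_mul, norm_div, norm_mul, norm_mul, Complex.norm_I, mul_comm Complex.I,
    Complex.norm_exp_ofReal_mul_I, Complex.norm_real, Complex.norm_real, Real.norm_eq_abs,
    Real.norm_eq_abs, one_mul, mul_one, abs_of_nonneg (by linarith : 0 ≤ 1 - |s|)]
  calc (1 - |s|) * (‖charFun ν (-s) - charFun γ (-s)‖ / |s|)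
      ≤ 1 * (‖charFun ν (-s) - charFun γ (-s)‖ / |s|) := by
        gcongr
        linarith
    _ ≤ M (-s) := by rw [one_mul, div_le_iff₀ hspos]; exact h2

theorem gaussianReal_real_Iic_sub_le {x y : ℝ} (hxy : x ≤ y) :
    (gaussianReal 0 1).real (Iic y) - (gaussianReal 0 1).real (Iic x) ≤ y - x := by
  have hd : (gaussianReal 0 1).real (Iic y) - (gaussianReal 0 1).real (Iic x)
      = (gaussianReal 0 1).real (Ioc x y) := by
    rw [← Iic_union_Ioc_eq_Iic hxy, measureReal_union (Iic_disjoint_Ioc le_rfl) measurableSet_Ioc]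
    ring
  rw [hd, measureReal_def, gaussianReal_apply_eq_integral _ one_ne_zero,
    ENNReal.toReal_ofReal (integral_nonneg fun _ => gaussianPDFReal_nonneg _ _ _)]
  calc ∫ t in Ioc x y, gaussianPDFReal 0 1 t ≤ ∫ t in Ioc x y, (1 : ℝ) := by
        refine setIntegral_mono_on (integrable_gaussianPDFReal 0 1).integrableOn (by simp)
          measurableSet_Ioc fun t _ => ?_
        rw [gaussianPDFReal]
        have h1 : (√(2 * Real.pi * (1 : NNReal)))⁻¹ ≤ 1 := by
          refine inv_le_one_of_one_le₀ (Real.one_le_sqrt.2 ?_)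
          have := Real.pi_gt_three
          norm_num
          linarith
        have h2 : Real.exp (-(t - 0) ^ 2 / (2 * (1 : NNReal))) ≤ 1 := by
          refine Real.exp_le_one_iff.2 ?_
          norm_num
          nlinarith [sq_nonneg t]
        calc _ ≤ (1 : ℝ) * 1 := by gcongr
          _ = 1 := one_mul 1
    _ = y - x := by simp [hxy]

/-- An Esseen-type bound for the distance to the standard normal distribution. -/
theorem abs_real_Iic_sub_gaussian_le {ν : Measure ℝ} [IsProbabilityMeasure ν]
    (hν : Integrable id ν) {T D : ℝ} (hT : 0 < T)
    (h : ∀ u : ℝ, |u| ≤ T → ‖charFun ν u - charFun (gaussianReal 0 1) u‖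
      ≤ D * |u| ^ 3 * Real.exp (-u ^ 2 / 4)) (hD : 0 ≤ D) (x : ℝ) :
    |ν.real (Iic x) - (gaussianReal 0 1).real (Iic x)| ≤ 32 / T + 64 * D := by
  -- Scaling by T turns the frequency range [-T, T] into [-1, 1] and the Lipschitz constant 1 of the
  -- normal distribution function into 1/T.
  have hcont : Measurable fun y : ℝ => T * y := by fun_prop
  have : IsProbabilityMeasure (ν.map (fun y => T * y)) := Measure.isProbabilityMeasure_map
    hcont.aemeasurable
  have : IsProbabilityMeasure ((gaussianReal 0 1).map (fun y => T * y)) :=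
    Measure.isProbabilityMeasure_map hcont.aemeasurable
  have hIic : ∀ (ρ : Measure ℝ) (y : ℝ), (ρ.map (fun y => T * y)).real (Iic y)
      = ρ.real (Iic (y / T)) := by
    intro ρ y
    rw [map_measureReal_apply hcont measurableSet_Iic]
    congr 1
    ext z
    simp only [mem_preimage, mem_Iic, le_div_iff₀ hT, mul_comm]
  have hmean : ∀ ρ : Measure ℝ, Integrable id ρ → Integrable id (ρ.map (fun y => T * y)) := by
    intro ρ hρ
    rw [integrable_map_measure aestronglyMeasurable_id hcont.aemeasurable]
    exact hρ.const_mul T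
  -- One factor |s| is split off |Ts|³; the remaining (Ts)² is absorbed by half of the Gaussian
  -- exponent, through y + 1 ≤ e^y at y = (Ts)²/8.
  set M : ℝ → ℝ := fun s => D * (8 * (T * Real.exp (-(T ^ 2 / 8) * s ^ 2))) with hM
  have hgi : Integrable fun s : ℝ => Real.exp (-(T ^ 2 / 8) * s ^ 2) :=
    integrable_exp_neg_mul_sq (by positivity)
  have hMi : Integrable M := ((hgi.const_mul T).const_mul 8).const_mul D
  have hgm : Integrable id (gaussianReal 0 1) :=
    (memLp_id_gaussianReal 1).integrable (by norm_num)
  have key := abs_real_Iic_sub_le (ν := ν.map (fun y => T * y))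
    (γ := (gaussianReal 0 1).map (fun y => T * y)) (hmean _ hν) (hmean _ hgm) (L := 1 / T) (M := M)
    (fun y z hyz => by
      rw [hIic, hIic]
      refine (gaussianReal_real_Iic_sub_le (div_le_div_of_nonneg_right hyz hT.le)).trans_eq ?_
      field_simp) hMi.intervalIntegrable (fun s hs => by
      rw [charFun_map_mul, charFun_map_mul]
      refine (h (T * s) (by rw [abs_mul, abs_of_pos hT]; nlinarith [abs_nonneg s])).trans ?_
      have h1 : (T * s) ^ 2 * Real.exp (-(T * s) ^ 2 / 4)
          ≤ 8 * Real.exp (-(T ^ 2 / 8) * s ^ 2) := by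
        have h2 := Real.add_one_le_exp ((T * s) ^ 2 / 8)
        have h3 : Real.exp (-(T ^ 2 / 8) * s ^ 2)
            = Real.exp ((T * s) ^ 2 / 8) * Real.exp (-(T * s) ^ 2 / 4) := by
          rw [← Real.exp_add]; ring_nf
        rw [h3, ← mul_assoc]
        refine mul_le_mul_of_nonneg_right ?_ (Real.exp_pos _).le
        linarith
      calc D * |T * s| ^ 3 * Real.exp (-(T * s) ^ 2 / 4)
          = D * (T * |s|) * ((T * s) ^ 2 * Real.exp (-(T * s) ^ 2 / 4)) := by
            rw [← sq_abs (T * s), abs_mul, abs_of_pos hT]; ring_nf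
        _ ≤ D * (T * |s|) * (8 * Real.exp (-(T ^ 2 / 8) * s ^ 2)) := by gcongr
        _ = M s * |s| := by simp only [hM]; ring) (T * x)
  rw [hIic, hIic, mul_div_cancel_left₀ _ hT.ne'] at key
  have hMint : ∫ s in (-1 : ℝ)..1, M s ≤ 64 * D := by
    rw [intervalIntegral.integral_of_le (by norm_num)]
    have hle : ∫ s in Ioc (-1 : ℝ) 1, M s ≤ ∫ s, M s :=
      setIntegral_le_integral hMi (ae_of_all _ fun s => by simp only [hM, Pi.zero_apply]; positivity)
    refine hle.trans ?_
    simp only [hM]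
    rw [integral_const_mul, integral_const_mul, integral_const_mul, integral_gaussian]
    have hs : T * √(Real.pi / (T ^ 2 / 8)) = √(8 * Real.pi) := by
      rw [show Real.pi / (T ^ 2 / 8) = 8 * Real.pi / T ^ 2 by field_simp,
        Real.sqrt_div' _ (sq_nonneg T), Real.sqrt_sq hT.le]
      field_simp
    have h8 : √(8 * Real.pi) ≤ 8 := by
      rw [Real.sqrt_le_left (by norm_num)]
      have := Real.pi_lt_four
      linarith
    rw [hs]
    nlinarith
  calc _ ≤ _ := key
    _ ≤ 32 / T + 64 * D := by
      rw [mul_one_div]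
      linarith

end LogPotential

end

/-! ### Taylor remainder and cumulant bounds. -/

noncomputable section

namespace LogPotential

open Complex Metric Filter Topology

theorem iteratedDeriv_comp_mul_left (c : ℂ) (f : ℂ → ℂ) (l : ℕ) :
    iteratedDeriv l (fun z => f (c * z)) = fun z => c ^ l * iteratedDeriv l f (c * z) := by
  induction l with
  | zero => simp
  | succ l ih =>
    funext z
    rw [iteratedDeriv_succ, ih, deriv_const_mul_field, deriv_comp_mul_left, iteratedDeriv_succ,
      smul_eq_mul]
    ring

/-- A third-order Taylor estimate from geometric bounds on the derivatives at the centre. -/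
theorem norm_le_of_norm_iteratedDeriv_le {R : ℂ → ℂ} {ρ s K : ℝ}
    (hR : DifferentiableOn ℂ R (ball 0 ρ)) (hs : 0 < s) (hK : 0 ≤ K)
    (h0 : ∀ k < 3, iteratedDeriv k R 0 = 0)
    (h : ∀ k, ‖iteratedDeriv (k + 3) R 0‖ ≤ (k + 3).factorial * (K / s ^ (k + 3)))
    {ξ : ℂ} (hξ : ξ ∈ ball 0 ρ) (hξs : ‖ξ‖ ≤ s / 2) :
    ‖R ξ‖ ≤ 2 * K * (‖ξ‖ / s) ^ 3 := by
  set q := ‖ξ‖ / s with hq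
  have hq0 : 0 ≤ q := by positivity
  have hq1 : q ≤ 1 / 2 := by
    rw [hq, div_le_iff₀ hs]; linarith
  have hsum := Complex.hasSum_taylorSeries_on_ball hR hξ
  rw [← hasSum_nat_add_iff' 3] at hsum
  have hz : ∑ i ∈ Finset.range 3, ((i.factorial : ℂ))⁻¹ • (ξ - 0) ^ i • iteratedDeriv i R 0 = 0 :=
    Finset.sum_eq_zero fun i hi => by rw [h0 i (Finset.mem_range.1 hi)]; simp
  rw [hz] at hsum
  simp only [sub_zero] at hsum
  rw [← hsum.tsum_eq]
  have hg : HasSum (fun k : ℕ => K * q ^ 3 * q ^ k) (K * q ^ 3 * (1 - q)⁻¹) :=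
    (hasSum_geometric_of_lt_one hq0 (by linarith)).mul_left _
  refine (tsum_of_norm_bounded hg fun k => ?_).trans ?_
  · have hf : (0 : ℝ) < (k + 3).factorial := by positivity
    rw [norm_smul, norm_smul, norm_inv, Complex.norm_natCast, norm_pow]
    calc ((k + 3).factorial : ℝ)⁻¹ * (‖ξ‖ ^ (k + 3) * ‖iteratedDeriv (k + 3) R 0‖)
        ≤ ((k + 3).factorial : ℝ)⁻¹ *
          (‖ξ‖ ^ (k + 3) * ((k + 3).factorial * (K / s ^ (k + 3)))) := by
          gcongr
          exact h k
      _ = K * q ^ (k + 3) := by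
          rw [hq, div_pow]
          field_simp
      _ = K * q ^ 3 * q ^ k := by ring
  · have : (1 - q)⁻¹ ≤ 2 := by
      rw [inv_le_comm₀ (by linarith) (by norm_num)]
      linarith
    calc K * q ^ 3 * (1 - q)⁻¹ ≤ K * q ^ 3 * 2 := by gcongr
      _ = _ := by ring

theorem norm_cexp_add_sub_le (a z : ℂ) :
    ‖exp (a + z) - exp a‖ ≤ Real.exp a.re * (‖z‖ * Real.exp ‖z‖) := by
  have h := Complex.norm_exp_sub_sum_le_norm_mul_exp z 1
  simp only [Finset.range_one, Finset.sum_singleton, pow_zero, Nat.factorial_zero, Nat.cast_one,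
    div_one, pow_one] at h
  rw [Complex.exp_add, show exp a * exp z - exp a = exp a * (exp z - 1) by ring, norm_mul,
    Complex.norm_exp]
  gcongr

theorem measurable_standardized {Ω : Type*} [MeasurableSpace Ω] {P : Measure Ω} {X : Ω → ℕ}
    (hX : Measurable X) :
    Measurable (standardized P X) := by
  have : Measurable fun ω => (X ω : ℝ) := measurable_from_top.comp hX
  unfold standardized
  fun_prop

theorem charFn_standardized {Ω : Type*} [MeasurableSpace Ω] {P : Measure Ω} {X : Ω → ℕ}
    (ξ : ℂ) :
    charFn P (standardized P X) ξ
      = exp (-((∫ ω, (X ω : ℝ) ∂P : ℝ) * (I / stdDev P X)) * ξ)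
        * pgf P X (exp (I / stdDev P X * ξ)) := by
  rw [charFn, pgf_exp, ← integral_const_mul]
  congr 1
  ext ω
  rw [← Complex.exp_add, standardized]
  congr 1
  push_cast
  ring

theorem charFun_map_standardized {Ω : Type*} [MeasurableSpace Ω] {P : Measure Ω}
    {X : Ω → ℕ} (hX : Measurable X) (u : ℝ) :
    charFun (P.map (standardized P X)) u = charFn P (standardized P X) u := by
  rw [charFun_apply_real, charFn, integral_map (measurable_standardized hX).aemeasurable
    (by fun_prop)]
  congr 1
  ext ω
  ring_nf

section

variable {Ω : Type*} [MeasurableSpace Ω] {P : Measure Ω} [IsProbabilityMeasure P]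
  {X : Ω → ℕ} {n : ℕ} {ε b : ℝ}

/-- Cumulants of a random variable with `b`-decreasing harmonic potential are controlled by the
variance. -/
theorem abs_normalizedCumulant_le (hX : Measurable X) (hn : ∀ᵐ ω ∂P, X ω ≤ n) (hε : 0 < ε)
    (hε1 : ε < 1) (hb : 0 ≤ b) (hdec : IsBDecreasingOn b (potential P X) (ball 1 ε))
    {φ : ℂ → ℂ} (hφ : DifferentiableOn ℂ φ (ball 0 (ε / 2)))
    (hφe : ∀ w ∈ ball 0 (ε / 2), exp w ∈ ball 1 ε ∧ exp (φ w) = pgf P X (exp w))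
    (hφc : ∀ j, iteratedDeriv j φ 0 = (cumulant P (fun ω => (X ω : ℝ)) j : ℂ)) (j : ℕ) :
    |normalizedCumulant P X (j + 2)| * (ε / 5) ^ (j + 2)
      ≤ (ε / 5) ^ 2 * stdDev P X ^ 2 + 2 * b := by
  -- Circles of radius r about points of modulus r stay in |w| ≤ 2ε/5, inside the disc of radius
  -- ε/2.
  set r := ε / 5 with hr
  have hr0 : 0 < r := by positivity
  have hp := Real.pi_pos
  have hD : ∀ z ∈ ball (1 : ℂ) ε, (starRingEnd ℂ) z ∈ ball (1 : ℂ) ε := by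
    intro z hz
    rw [mem_ball, dist_eq_norm] at hz ⊢
    rwa [← map_one (starRingEnd ℂ), ← map_sub, Complex.norm_conj]
  have hre : ∀ w ∈ ball (0 : ℂ) (ε / 2), (φ w).re = potential P X (exp w) := by
    intro w hw
    rw [potential, ← (hφe w hw).2, Complex.norm_exp, Real.log_exp]
  have hg : DifferentiableOn ℂ (deriv φ) (ball 0 (ε / 2)) := hφ.deriv isOpen_ball
  have hgc : ∀ k, iteratedDeriv k (deriv φ) 0
      = (cumulant P (fun ω => (X ω : ℝ)) (k + 1) : ℂ) := by
    intro k
    rw [← hφc, iteratedDeriv_succ']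
  have hsub : closedBall (0 : ℂ) r ⊆ ball 0 (ε / 2) := closedBall_subset_ball (by linarith)
  have hodd : ∀ t, (deriv φ (circleMap 0 r (-t))).im = -(deriv φ (circleMap 0 r t)).im := by
    intro t
    have h1 : circleMap 0 r (-t) = (starRingEnd ℂ) (circleMap 0 r t) := by
      simp [circleMap, ← Complex.exp_conj]
    rw [h1, conj_eq_of_iteratedDeriv_real hg (fun k => by rw [hgc]; simp)
      (hsub (circleMap_mem_closedBall 0 hr0.le t)), Complex.conj_im]
  have hlow : ∀ t ∈ Set.Icc 0 Real.pi,
      -(2 * b / (Real.pi * r)) ≤ (deriv φ (circleMap 0 r t)).im := by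
    intro t ht
    set w := circleMap 0 r t with hw
    have hwr : ‖w‖ = r := by
      rw [hw, circleMap_zero, norm_mul, Complex.norm_exp_ofReal_mul_I, mul_one, Complex.norm_real,
        Real.norm_of_nonneg hr0.le]
    have hwim : 0 ≤ w.im := by
      have : w.im = r * Real.sin t := by
        rw [hw, circleMap_zero, Complex.im_ofReal_mul, Complex.exp_ofReal_mul_I_im]
      rw [this]
      exact mul_nonneg hr0.le (Real.sin_nonneg_of_mem_Icc ht)
    have hsub' : closedBall w r ⊆ ball 0 (ε / 2) :=
      closedBall_subset_ball' (by rw [dist_zero_right, hwr]; linarith)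
    refine neg_le_im_deriv hr0 (hφ.diffContOnCl_ball hsub') fun s hs => ?_
    have hm1 := hsub' (circleMap_mem_closedBall w hr0.le s)
    have hm2 := hsub' (circleMap_mem_closedBall w hr0.le (-s))
    have him : ∀ u, (circleMap w r u).im = w.im + r * Real.sin u := by
      intro u
      rw [circleMap, Complex.add_im, Complex.im_ofReal_mul, Complex.exp_ofReal_mul_I_im]
    have hrr : ∀ u, (circleMap w r u).re = w.re + r * Real.cos u := by
      intro u
      rw [circleMap, Complex.add_re, Complex.re_ofReal_mul, Complex.exp_ofReal_mul_I_re]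
    have hsin : 0 ≤ r * Real.sin s := mul_nonneg hr0.le (Real.sin_nonneg_of_mem_Icc hs)
    rw [hre _ hm1, hre _ hm2]
    refine hdec.potential_exp_sub_le hX hn hD ?_ ?_ ?_ (hφe _ hm2).1 (hφe _ hm1).1
    · rw [hrr, hrr, Real.cos_neg]
    · rw [him, him, Real.sin_neg, abs_le]
      constructor <;> linarith
    · have h1 := (Complex.abs_im_le_norm (circleMap w r s)).trans
        (mem_ball_zero_iff.1 hm1).le
      have h2 := le_abs_self (circleMap w r s).im
      have h3 := Real.pi_gt_three
      linarith
  have key := abs_coeff_le_of_im_ge hr0 (hg.diffContOnCl_ball hsub) hodd hlow (by positivity) j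
  have hc2 : (deriv (deriv φ) 0).re = stdDev P X ^ 2 := by
    have := hgc 1
    rw [iteratedDeriv_one] at this
    rw [this, Complex.ofReal_re, (cumulant_one_two hX hn).2]
  rw [hc2, hgc, Complex.ofReal_re] at key
  -- Integrating φ' divides its coefficient by j + 2, which cancels the growth factor j + 1 of the
  -- Rogosinski bound.
  have hfac : normalizedCumulant P X (j + 2)
      = cumulant P (fun ω => (X ω : ℝ)) (j + 2) / (j + 1).factorial / (j + 2) := by
    rw [normalizedCumulant, Nat.factorial_succ (j + 1)]
    push_cast
    field_simp
    ring
  have hj : (0 : ℝ) < (j : ℝ) + 2 := by positivity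
  set Q := |cumulant P (fun ω => (X ω : ℝ)) (j + 2) / (j + 1).factorial| with hQ
  rw [hfac, abs_div, abs_of_pos hj]
  have hB : r * (8 * (2 * b / (Real.pi * r)) / Real.pi) ≤ 2 * b := by
    have : r * (8 * (2 * b / (Real.pi * r)) / Real.pi) = 16 * b / Real.pi ^ 2 := by
      field_simp
      ring
    rw [this, div_le_iff₀ (by positivity)]
    have := Real.pi_gt_three
    have : 9 ≤ Real.pi ^ 2 := by nlinarith
    nlinarith
  calc Q / (j + 2) * r ^ (j + 2) = r / (j + 2) * (r ^ (j + 1) * Q) := by ring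
    _ ≤ r / (j + 2) * ((j + 1) * (r * stdDev P X ^ 2 + 8 * (2 * b / (Real.pi * r)) / Real.pi)) := by
        gcongr
    _ = (j + 1) / (j + 2) *
        (r ^ 2 * stdDev P X ^ 2 + r * (8 * (2 * b / (Real.pi * r)) / Real.pi)) := by ring
    _ ≤ 1 * (r ^ 2 * stdDev P X ^ 2 + 2 * b) := by
        gcongr
        rw [div_le_one hj]
        linarith
    _ = _ := one_mul _

/-- If all terms satisfy `|a_j| r ^ j ≤ S + 2 b` and the sum at radius `5 r / 32` exceeds `b`, then
`b` is small compared with `S`. -/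
theorem le_div_four_of_lt_tsum {a : ℕ → ℝ} {r S : ℝ} (hb : 0 ≤ b) (hr : 0 < r)
    (ha : ∀ j, |a j| * r ^ (j + 2) ≤ S + 2 * b)
    (hsum : b < ∑' j : ℕ, |a j| * (5 * r / 32) ^ (j + 2)) : b ≤ S / 4 ∧ 0 < S := by
  -- The geometric sum is (25/864)(S + 2b); being larger than b ≥ 0, it forces both conclusions.
  have hg : HasSum (fun j : ℕ => (S + 2 * b) * (5 / 32) ^ 2 * (5 / 32 : ℝ) ^ j)
      ((S + 2 * b) * (5 / 32) ^ 2 * (1 - 5 / 32)⁻¹) :=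
    (hasSum_geometric_of_lt_one (by norm_num) (by norm_num)).mul_left _
  have hle : ∀ j, |a j| * (5 * r / 32) ^ (j + 2)
      ≤ (S + 2 * b) * (5 / 32) ^ 2 * (5 / 32 : ℝ) ^ j := by
    intro j
    calc |a j| * (5 * r / 32) ^ (j + 2) = |a j| * r ^ (j + 2) * (5 / 32) ^ (j + 2) := by
          rw [show 5 * r / 32 = r * (5 / 32) by ring, mul_pow]; ring
      _ ≤ (S + 2 * b) * (5 / 32) ^ (j + 2) := by gcongr; exact ha j
      _ = _ := by ring
  have hsummable : Summable fun j : ℕ => |a j| * (5 * r / 32) ^ (j + 2) :=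
    Summable.of_nonneg_of_le (fun j => by positivity) hle hg.summable
  have := hsummable.tsum_le_tsum hle hg.summable
  rw [hg.tsum_eq] at this
  constructor <;> norm_num at this <;> linarith

theorem integrable_standardized (hX : Measurable X) (hn : ∀ᵐ ω ∂P, X ω ≤ n) :
    Integrable (standardized P X) P :=
  (((memLp_two_of_le hX hn).integrable (by norm_num)).sub (integrable_const _)).div_const _

end

end LogPotential

end

/-! ### The main theorem. -/

theorem mainTheorem5 :
    ∃ c₁ c₂ C : ℝ, 0 < c₁ ∧ 0 < c₂ ∧ c₂ < 1 / 2 ∧ 0 < C ∧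
      ∀ (Ω : Type*) [MeasurableSpace Ω] (P : Measure Ω) [IsProbabilityMeasure P]
        (n : ℕ) (X : Ω → ℕ), Measurable X → (∀ᵐ ω ∂P, X ω ≤ n) →
      ∀ ε b : ℝ, 0 < ε → ε < 1 → 0 ≤ b →
        LogPotential.IsBDecreasingOn b (LogPotential.potential P X) (Metric.ball 1 ε) →
        InnerProductSpace.HarmonicOnNhd (LogPotential.potential P X) (Metric.ball 1 ε) →
        b < ∑' j : ℕ, |LogPotential.normalizedCumulant P X (j + 2)| * (ε / 32) ^ (j + 2) →
        0 < LogPotential.stdDev P X ∧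
        (∃ R : ℂ → ℂ,
          DifferentiableOn ℂ R (Metric.ball 0 (ε * LogPotential.stdDev P X / 2)) ∧
          (∀ ξ : ℂ, ‖ξ‖ < ε * LogPotential.stdDev P X / 2 →
            LogPotential.charFn P (LogPotential.standardized P X) ξ
              = Complex.exp (-ξ ^ 2 / 2 + R ξ)) ∧
          R 0 = 0 ∧ iteratedDeriv 1 R 0 = 0 ∧ iteratedDeriv 2 R 0 = 0 ∧
          (∀ l : ℕ, 3 ≤ l → ‖iteratedDeriv l R 0‖
            ≤ (Nat.factorial l : ℝ) * (c₂ * ε * LogPotential.stdDev P X) ^ ((2 : ℤ) - (l : ℤ))) ∧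
          (∀ ξ : ℂ, ‖ξ‖ ≤ c₂ * ε * LogPotential.stdDev P X →
            ‖R ξ‖ ≤ c₁ * ‖ξ‖ ^ 3 / (ε * LogPotential.stdDev P X))) ∧
        (∀ t : ℝ, |P.real {ω | LogPotential.standardized P X ω ≤ t}
            - (gaussianReal 0 1).real (Set.Iic t)| ≤ C / (ε * LogPotential.stdDev P X)) := by
  -- With s = εσ/5: c₂εσ = s/2, where the geometric tail costs a factor 2; 2·(3/2)s²(|ξ|/s)³ =
  -- 15|ξ|³/(εσ); and 32/T + 64D with T = εσ/60, D = 15/(εσ) is (1920 + 960)/(εσ).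
  refine ⟨15, 1 / 10, 2880, by norm_num, by norm_num, by norm_num, by norm_num, ?_⟩
  intro Ω _ P _ n X hX hn ε b hε hε1 hb hdec hharm hsum
  obtain ⟨φ, hφ, hφ0, hφe, hφc⟩ := LogPotential.exists_log_pgf hX hn hε hε1 hharm
  have hcoef := LogPotential.abs_normalizedCumulant_le hX hn hε hε1 hb hdec hφ hφe hφc
  obtain ⟨hκ1, hκ2⟩ := LogPotential.cumulant_one_two hX hn
  set σ := LogPotential.stdDev P X with hσdef
  set μ : ℝ := ∫ ω, (X ω : ℝ) ∂P with hμ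
  have hbS := LogPotential.le_div_four_of_lt_tsum hb (by positivity : 0 < ε / 5)
    hcoef (by rwa [show 5 * (ε / 5) / 32 = ε / 32 by ring])
  have hσ0 : 0 ≤ σ := Real.sqrt_nonneg _
  have hσ : 0 < σ := by
    rcases hσ0.eq_or_lt with h | h
    · rw [← h] at hbS
      simp at hbS
    · exact h
  set s := ε / 5 * σ with hs
  have hs0 : 0 < s := by positivity
  have hσc : (σ : ℂ) ≠ 0 := by exact_mod_cast hσ.ne'
  set c : ℂ := Complex.I / σ with hc
  have hcn : ‖c‖ = 1 / σ := by
    rw [hc, norm_div, Complex.norm_I, Complex.norm_real, Real.norm_of_nonneg hσ0]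
  have hcmem : ∀ ξ ∈ Metric.ball (0 : ℂ) (ε * σ / 2), c * ξ ∈ Metric.ball (0 : ℂ) (ε / 2) := by
    intro ξ hξ
    rw [mem_ball_zero_iff] at hξ ⊢
    rw [norm_mul, hcn, one_div, ← div_eq_inv_mul, div_lt_iff₀ hσ]
    linarith
  -- Subtracting the linear term removes the mean, and adding ξ²/2 cancels the variance. The power ξ
  -- ^ 1 lets both corrections be differentiated as monomials.
  set R : ℂ → ℂ := fun ξ => φ (c * ξ) - (μ * c) * ξ ^ 1 + (1 / 2) * ξ ^ 2 with hR
  have hRd : DifferentiableOn ℂ R (Metric.ball 0 (ε * σ / 2)) := by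
    have h1 : DifferentiableOn ℂ (fun ξ => φ (c * ξ)) (Metric.ball 0 (ε * σ / 2)) :=
      hφ.comp (f := fun ξ => c * ξ) (by fun_prop) hcmem
    exact (h1.sub (by fun_prop)).add (by fun_prop)
  have hexp : ∀ ξ : ℂ, ‖ξ‖ < ε * σ / 2 →
      LogPotential.charFn P (LogPotential.standardized P X) ξ = Complex.exp (-ξ ^ 2 / 2 + R ξ) := by
    intro ξ hξ
    rw [LogPotential.charFn_standardized, ← (hφe _ (hcmem ξ (mem_ball_zero_iff.2 hξ))).2,
      ← Complex.exp_add]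
    congr 1
    simp only [hR]
    ring
  have hder : ∀ l, iteratedDeriv l R 0
      = c ^ l * LogPotential.cumulant P (fun ω => (X ω : ℝ)) l
        - (μ * c) * (if l = 1 then 1 else 0) + (1 / 2) * (if l = 2 then 2 else 0) := by
    intro l
    have h1 : ContDiffAt ℂ l (fun ξ => φ (c * ξ)) 0 := by
      have han : AnalyticAt ℂ φ (c * 0) := by
        rw [mul_zero]
        exact hφ.analyticAt (Metric.ball_mem_nhds 0 (by linarith))
      exact (han.comp (f := fun ξ => c * ξ) (by fun_prop)).contDiffAt
    rw [hR, iteratedDeriv_fun_add (h1.sub (by fun_prop)) (by fun_prop),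
      iteratedDeriv_fun_sub h1 (by fun_prop), iteratedDeriv_const_mul_field,
      iteratedDeriv_const_mul_field, iteratedDeriv_fun_pow_zero, iteratedDeriv_fun_pow_zero,
      LogPotential.iteratedDeriv_comp_mul_left]
    simp [hφc]
  have hR0 : R 0 = 0 := by simp [hR, hφ0]
  have hR1 : iteratedDeriv 1 R 0 = 0 := by
    rw [hder, hκ1]
    simp
    ring
  have hR2 : iteratedDeriv 2 R 0 = 0 := by
    rw [hder, hκ2, hc]
    push_cast
    rw [div_pow, Complex.I_sq]
    field_simp
    simp
  -- The factor 3/2 comes from s² + 2b with b ≤ s²/4.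
  have hR3 : ∀ k, ‖iteratedDeriv (k + 3) R 0‖
      ≤ (k + 3).factorial * (3 / 2 * s ^ 2 / s ^ (k + 3)) := by
    intro k
    rw [hder, if_neg (by omega), if_neg (by omega), mul_zero, mul_zero, sub_zero, add_zero,
      norm_mul, norm_pow, hcn, Complex.norm_real, Real.norm_eq_abs]
    have h1 := hcoef (k + 1)
    rw [LogPotential.normalizedCumulant, abs_div, Nat.abs_cast] at h1
    have hf : (0 : ℝ) < (k + 3).factorial := by positivity
    set κ := |LogPotential.cumulant P (fun ω => (X ω : ℝ)) (k + 3)| with hκ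
    have h2 : κ / (k + 3).factorial * (ε / 5) ^ (k + 3) ≤ 3 / 2 * s ^ 2 := by
      have : (ε / 5) ^ 2 * σ ^ 2 = s ^ 2 := by rw [hs]; ring
      rw [this] at h1 hbS
      exact h1.trans (by linarith)
    calc (1 / σ) ^ (k + 3) * κ
        = (k + 3).factorial * (κ / (k + 3).factorial * (ε / 5) ^ (k + 3) / s ^ (k + 3)) := by
          rw [hs, mul_pow, one_div, inv_pow]
          field_simp
      _ ≤ _ := by gcongr
  have hRb : ∀ ξ : ℂ, ‖ξ‖ ≤ 1 / 10 * ε * σ → ‖R ξ‖ ≤ 15 * ‖ξ‖ ^ 3 / (ε * σ) := by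
    intro ξ hξ
    have hεσ : 0 < ε * σ := by positivity
    have := LogPotential.norm_le_of_norm_iteratedDeriv_le hRd hs0 (by positivity)
      (fun k hk => by
        interval_cases k
        · simpa using hR0
        · exact hR1
        · exact hR2) hR3 (ξ := ξ) (mem_ball_zero_iff.2 (by linarith)) (by rw [hs]; linarith)
    refine this.trans_eq ?_
    rw [hs]
    field_simp
    ring
  refine ⟨hσ, ⟨R, hRd, hexp, hR0, hR1, hR2, ?_, hRb⟩, ?_⟩
  · intro l hl
    obtain ⟨k, rfl⟩ := Nat.exists_eq_add_of_le' hl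
    refine (hR3 k).trans ?_
    gcongr
    -- Halving the radius s gains 2^(k+1) ≥ 2, which absorbs the 3/2.
    have h1 : (1 / 10 * ε * σ) ^ ((2 : ℤ) - ((k + 3 : ℕ) : ℤ)) = 2 ^ (k + 1) / s ^ (k + 1) := by
      rw [show (2 : ℤ) - ((k + 3 : ℕ) : ℤ) = -((k + 1 : ℕ) : ℤ) by push_cast; ring, zpow_neg,
        zpow_natCast, show 1 / 10 * ε * σ = s / 2 by rw [hs]; ring, div_pow, inv_div]
    have h2 : 3 / 2 * s ^ 2 / s ^ (k + 3) = 3 / 2 / s ^ (k + 1) := by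
      rw [pow_add s k 3, pow_succ s k]
      field_simp
    rw [h1, h2]
    gcongr
    calc (3 / 2 : ℝ) ≤ 2 ^ 1 := by norm_num
      _ ≤ 2 ^ (k + 1) := pow_le_pow_right₀ (by norm_num) (by omega)
  · intro t
    have hεσ : 0 < ε * σ := by positivity
    have hm := LogPotential.measurable_standardized (P := P) hX
    have : IsProbabilityMeasure (P.map (LogPotential.standardized P X)) :=
      Measure.isProbabilityMeasure_map hm.aemeasurable
    have hint : Integrable id (P.map (LogPotential.standardized P X)) := by
      rw [integrable_map_measure aestronglyMeasurable_id hm.aemeasurable]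
      exact LogPotential.integrable_standardized hX hn
    have key := LogPotential.abs_real_Iic_sub_gaussian_le hint (T := ε * σ / 60)
      (D := 15 / (ε * σ)) (by positivity) (fun u hu => by
        have hu' : ‖(u : ℂ)‖ = |u| := by rw [Complex.norm_real, Real.norm_eq_abs]
        have hRu := hRb u (by rw [hu']; linarith)
        rw [hu'] at hRu
        -- T = εσ/60 is exactly the range where 15|u|³/(εσ) ≤ u²/4, so e^|R| uses up only half of
        -- the Gaussian decay.
        have hR4 : ‖R u‖ ≤ u ^ 2 / 4 := by
          refine hRu.trans ?_
          rw [div_le_iff₀ hεσ, ← sq_abs u]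
          nlinarith [mul_le_mul_of_nonneg_left hu (sq_nonneg |u|)]
        have hg : charFun (gaussianReal 0 1) u = Complex.exp (-(u : ℂ) ^ 2 / 2) := by
          rw [charFun_gaussianReal]
          congr 1
          simp
          ring
        rw [LogPotential.charFun_map_standardized hX, hexp _ (by rw [hu']; linarith), hg]
        refine (LogPotential.norm_cexp_add_sub_le _ _).trans ?_
        have hre : (-(u : ℂ) ^ 2 / 2).re = -u ^ 2 / 2 := by
          rw [show -(u : ℂ) ^ 2 / 2 = ((-u ^ 2 / 2 : ℝ) : ℂ) by push_cast; ring,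
            Complex.ofReal_re]
        rw [hre]
        calc Real.exp (-u ^ 2 / 2) * (‖R u‖ * Real.exp ‖R u‖)
            ≤ Real.exp (-u ^ 2 / 2) * (15 * |u| ^ 3 / (ε * σ) * Real.exp (u ^ 2 / 4)) := by
              gcongr
          _ = 15 / (ε * σ) * |u| ^ 3 * (Real.exp (-u ^ 2 / 2) * Real.exp (u ^ 2 / 4)) := by ring
          _ = 15 / (ε * σ) * |u| ^ 3 * Real.exp (-u ^ 2 / 4) := by
              rw [← Real.exp_add]; ring_nf) (by positivity) t
    rw [map_measureReal_apply hm measurableSet_Iic] at key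
    refine key.trans_eq ?_
    field_simp
    norm_num
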